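/- **Notation.** For families $\mathcal U,\mathcal V$ of subsets of a set $X$ write $\mathcal U\preceq\mathcal V$ if every $V\in\mathcal V$ is contained in some $U\in\mathcal U$, and put $\mathcal U\vee\mathcal V=\{U\cap V\mid U\in\mathcal U,\ V\in\mathcal V\}$; for a bijection $g$ of $X$ put $g(\mathcal U)=\{g(U)\mid U\in\mathcal U\}$. For finite $E,F\subseteq X$ let $\mu(E,F,\mathcal U)$ be the largest cardinality of a set $D\subseteq E$ that admits an injective map $\varphi\colon D\to F$ such that for each $x\in D$ some $U\in\mathcal U$ contains both $x$ and $\varphi(x)$. Let $G$ be a topological group and let $G_r$ be $G$ with its right uniformity, whose uniform coverings are the families $\mathcal U$ of subsets of $G$ with $\mathcal U\preceq\{Vx\mid x\in G\}$ for some neighbourhood $V$ of the identity. The group $G$ acts on $G_r$ by the uniform automorphisms $x\mapsto gx$. Let $\mathcal N(G_r)$ be the set of finite uniform coverings of $G_r$, and for $\mathcal U\in\mathcal N(G_r)$ let $N(\mathcal U)=\min\{|\mathcal V|\mid\mathcal V\in\mathcal N(G_r),\ \mathcal U\preceq\mathcal V\}$. The *asymptotic uniform complexity* and the *mean topological matching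 number* of $G$ are $$\omega(G)=\sup_{E}\ \sup_{\mathcal U\in\mathcal N(G_r)}\ \inf_{\substack{\mathcal V\in\mathcal N(G_r)\\ \mathcal U\preceq\mathcal V}}\ \sup_{g\in E}\frac{N(\mathcal V\vee g(\mathcal V))}{N(\mathcal V)},\qquad \mu(G)=\inf_{E}\ \inf_{\mathcal U\in\mathcal N(G_r)}\ \sup_{F}\ \inf_{g\in E}\frac{\mu(F,gF,\mathcal U)}{|F|},$$ where $E$ runs through the finite subsets of $G$ and $F$ through the non-empty finite subsets of $G$; suprema and infima are taken in $[-\infty,\infty]$. Let $UC_b(G_r)$ be the space of bounded uniformly continuous functions $G_r\to\mathbb R$. The group $G$ is *amenable* if there is a linear map $m\colon UC_b(G_r)\to\mathbb R$ such that $\inf_{x\in G}f(x)\le m(f)\le\sup_{x\in G}f(x)$ and $m(f)=m(x\mapsto f(gx))$ for all $f\in UC_b(G_r)$ and $g\in G$. **Statement.** Let $G$ be a non-discrete Hausdorff topological group. Then $\omega(G)=2-\mu(G)$. Moreover, $G$ is amenable if and only if $\omega(G)=1$. -/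

import Mathlib

open Set Topology Uniformity

noncomputable section

namespace AsympUnif

/-! ### Families of subsets and uniform coverings -/

/-- `𝒱` refines `𝒰` (written `𝒰 ≼ 𝒱`): every member of `𝒱` is contained in some member of `𝒰`. -/
def Refines {X : Type*} (𝒰 𝒱 : Set (Set X)) : Prop :=
  ∀ V ∈ 𝒱, ∃ U ∈ 𝒰, V ⊆ U

/-- `𝒰 ∨ 𝒱 = {U ∩ V | U ∈ 𝒰, V ∈ 𝒱}`. -/
def join {X : Type*} (𝒰 𝒱 : Set (Set X)) : Set (Set X) :=
  {W | ∃ U ∈ 𝒰, ∃ V ∈ 𝒱, W = U ∩ V}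

/-- `g(𝒰) = {g(U) | U ∈ 𝒰}`. -/
def imageFamily {X : Type*} (g : Equiv.Perm X) (𝒰 : Set (Set X)) : Set (Set X) :=
  (fun U => g '' U) '' 𝒰

/-- Uniform coverings of a uniform space: families of subsets refined by the family of balls
`{y | (x, y) ∈ W}`, `x ∈ X`, for some entourage `W`. -/
def IsUniformCovering {X : Type*} [UniformSpace X] (𝒰 : Set (Set X)) : Prop :=
  ∃ W ∈ 𝓤 X, ∀ x : X, ∃ U ∈ 𝒰, {y | (x, y) ∈ W} ⊆ U

/-- `𝒩(X)`: the set of finite uniform coverings of `X`. -/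
def finUnifCov (X : Type*) [UniformSpace X] : Set (Set (Set X)) :=
  {𝒰 | 𝒰.Finite ∧ IsUniformCovering 𝒰}

/-- The uniform complexity `N(𝒰)`: the least cardinality of a finite uniform covering
refining `𝒰`. -/
def complexity {X : Type*} [UniformSpace X] (𝒰 : Set (Set X)) : ℕ :=
  sInf {n | ∃ 𝒱 ∈ finUnifCov X, Refines 𝒰 𝒱 ∧ 𝒱.ncard = n}

/-! ### Automorphisms of uniform spaces -/

/-- `Aut(X)`: the group of all bijections of `X` that are uniformly continuous together with
their inverse. -/
def unifAut (X : Type*) [UniformSpace X] : Subgroup (Equiv.Perm X) where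
  carrier := {σ | UniformContinuous σ ∧ UniformContinuous σ.symm}
  mul_mem' := fun {_ _} ha hb => ⟨ha.1.comp hb.1, hb.2.comp ha.2⟩
  one_mem' := ⟨uniformContinuous_id, uniformContinuous_id⟩
  inv_mem' := fun {_} ha => ⟨ha.2, ha.1⟩

/-! ### Matchings -/

/-- The matching number `ν(E, F, R)` of the bipartite graph `(E, F, R)`: the largest size of the
domain `D ⊆ E` of an injective map `φ : D → F` with `(x, φ x) ∈ R` for all `x ∈ D`. -/
def matchingNumber {α β : Type*} (E : Finset α) (F : Finset β) (R : α → β → Prop) : ℕ :=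
  sSup {n | ∃ D ⊆ E, ∃ φ : {x // x ∈ D} → β, Function.Injective φ ∧
    (∀ x : {x // x ∈ D}, φ x ∈ F ∧ R x (φ x)) ∧ D.card = n}

/-- `μ(E, F, 𝒰)`: the matching number of the bipartite graph on `E` and `F` in which `x` and `y`
are joined if and only if some member of `𝒰` contains both. -/
def coverMatching {X : Type*} (E F : Finset X) (𝒰 : Set (Set X)) : ℕ :=
  matchingNumber E F (fun x y => ∃ U ∈ 𝒰, x ∈ U ∧ y ∈ U)

/-! ### The two invariants of a dynamical system `(X, H)`, `H` a subgroup of `Aut(X)`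

The suprema and infima are taken in the complete lattice of extended reals, so that each of them
is a genuine least upper bound or greatest lower bound. -/

/-- The mean topological matching number `μ(X, H)`. -/
def meanMatching {X : Type*} [UniformSpace X] (H : Subgroup (unifAut X)) : EReal :=
  ⨅ E : Finset H, ⨅ 𝒰 ∈ finUnifCov X, ⨆ (F : Finset X) (_ : F.Nonempty), ⨅ g ∈ E,
    (((coverMatching F (F.map (g : Equiv.Perm X).toEmbedding) 𝒰 : ℝ) / (F.card : ℝ) : ℝ) : EReal)

/-- The asymptotic uniform complexity `ω(X, H)`. -/
def asympComplexity {X : Type*} [UniformSpace X] (H : Subgroup (unifAut X)) : EReal :=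
  ⨆ E : Finset H, ⨆ 𝒰 ∈ finUnifCov X, ⨅ 𝒱 ∈ {𝒱 ∈ finUnifCov X | Refines 𝒰 𝒱}, ⨆ g ∈ E,
    (((complexity (join 𝒱 (imageFamily (g : Equiv.Perm X) 𝒱)) : ℝ) / (complexity 𝒱 : ℝ) : ℝ) :
      EReal)

/-! ### Amenability -/

/-- `UC_b(X)`: the bounded uniformly continuous real-valued functions on `X`. -/
def UCb (X : Type*) [UniformSpace X] : Submodule ℝ (X → ℝ) where
  carrier := {f | UniformContinuous f ∧ ∃ C : ℝ, ∀ x, |f x| ≤ C}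
  add_mem' := by
    rintro f g ⟨hf, C, hC⟩ ⟨hg, D, hD⟩
    exact ⟨hf.add hg, C + D, fun x => (abs_add_le _ _).trans (add_le_add (hC x) (hD x))⟩
  zero_mem' := ⟨uniformContinuous_const, 0, fun x => by simp⟩
  smul_mem' := by
    rintro c f ⟨hf, C, hC⟩
    refine ⟨hf.const_smul c, |c| * C, fun x => ?_⟩
    simpa [abs_mul] using mul_le_mul_of_nonneg_left (hC x) (abs_nonneg c)

/-- A mean on a linear space of bounded functions: a linear functional `m` with
`inf f ≤ m f ≤ sup f`. -/
def IsMean {X : Type*} {L : Submodule ℝ (X → ℝ)} (m : L →ₗ[ℝ] ℝ) : Prop :=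
  ∀ f : L, (⨅ x, (f : X → ℝ) x) ≤ m f ∧ m f ≤ ⨆ x, (f : X → ℝ) x

/-- The dynamical system `(X, H)` is amenable: there is a mean on `UC_b(X)` with
`m (f ∘ g) = m f` for all `f ∈ UC_b(X)` and `g ∈ H`. -/
def IsAmenable {X : Type*} [UniformSpace X] (H : Subgroup (unifAut X)) : Prop :=
  ∃ m : UCb X →ₗ[ℝ] ℝ, IsMean m ∧ ∀ g ∈ H, ∀ f f' : UCb X,
    (f' : X → ℝ) = (f : X → ℝ) ∘ (g : Equiv.Perm X) → m f = m f'

/-! ### Topological groups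

A topological group is regarded as a uniform space through its right uniformity, whose uniform
coverings are the families refined by `{V x | x ∈ G}` for some neighbourhood `V` of `1`. -/

section Group

attribute [local instance] IsTopologicalGroup.rightUniformSpace

variable (G : Type*) [Group G] [TopologicalSpace G] [IsTopologicalGroup G]

/-- Left translations are uniformly continuous for the right uniformity. -/
theorem uniformContinuous_leftMul (g : G) : UniformContinuous (fun x : G => g * x) := by
  have hc : Filter.Tendsto (fun z : G => g * z * g⁻¹) (𝓝 1) (𝓝 1) := by
    have h : Continuous (fun z : G => g * z * g⁻¹) := by fun_prop
    simpa using h.tendsto 1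
  have h2 : Filter.Tendsto (fun p : G × G => g * (p.2 * p.1⁻¹) * g⁻¹) (𝓤 G) (𝓝 1) :=
    hc.comp Filter.tendsto_comap
  refine Filter.tendsto_comap_iff.2 (h2.congr fun p => ?_)
  simp [mul_assoc]

/-- The homomorphism `λ_G : G → Aut(G_r)`, `λ_G(g)(x) = g x`. -/
def leftTranslation : G →* unifAut G :=
  (MulAction.toPermHom G G).codRestrict (unifAut G) fun g =>
    ⟨uniformContinuous_leftMul G g, uniformContinuous_leftMul G g⁻¹⟩

/-- The asymptotic uniform complexity `ω(G) = ω(G_r, λ_G(G))` of a topological group. -/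
def groupComplexity : EReal :=
  asympComplexity (leftTranslation G).range

/-- The mean topological matching number `μ(G) = μ(G_r, λ_G(G))` of a topological group. -/
def groupMatching : EReal :=
  meanMatching (leftTranslation G).range

/-- Amenability of a topological group `G`, that is, of `(G_r, λ_G(G))`. -/
def GroupAmenable : Prop :=
  IsAmenable (leftTranslation G).range

end Group

end AsympUnif

end

namespace AsympUnif

/-! ### Matchings in bipartite graphs -/

/-! A refinement of `𝒱 ∨ g(𝒱)` is read as the edge set of a bipartite graph: a set inside `U ∩ g(V)`
is an edge from `U` to `V`.

Bound `ω ≥ 2 - μ`: if `𝒱` has complexity `n`, minimality and Hall's theorem force the edges to reach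
`n` distinct vertices on each side (`exists_injective_of_minimal`), and a König-type count then
gives at least `2n - ν` edges, `ν` being the matching number (`exists_matching_of_edges`). When `𝒱`
is fine, such a matching becomes one between `F` and `gF` along `𝒰`, where `F` has one point near
each member of a minimal refinement of `𝒱` (`exists_le_coverMatching_add_complexity`).

Bound `ω ≤ 2 - μ`: puncture `𝒰` at `n` points in general position and add one neighbourhood per
point. The complexity is at least `n`. A refinement of the join needs one set for each point of `F`
and of `gF`, a matched pair sharing a single set, and at most `|𝒰|²` further sets
(`complexity_join_le`). Since `G` is not discrete, `n` can be made so large that this last term is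
negligible.

Amenability amounts to `μ = 1`. By Hahn–Banach an invariant mean yields almost invariant finite
averages; tested on maxima of Urysohn functions, these give Hall's condition with small defect.
Conversely, almost perfect matchings make averages over `F` almost invariant, and an ultrafilter
limit of these is an invariant mean. -/

/-- Hall's theorem with defect `d`. -/
theorem exists_partial_transversal {I J : Type*} [Fintype I] [DecidableEq J] [Nonempty J]
    (t : I → Finset J) (d : ℕ)
    (h : ∀ S : Finset I, S.card ≤ (S.biUnion t).card + d) :
    ∃ (D : Finset I) (f : I → J), Set.InjOn f D ∧ (∀ i ∈ D, f i ∈ t i) ∧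
      Fintype.card I ≤ D.card + d := by
  classical
  -- Adjoin `d` dummy elements to every `t i` and apply Hall's theorem; at most `d` indices are sent
  -- to dummies.
  obtain ⟨f, hf, hft⟩ := (Finset.all_card_le_biUnion_card_iff_exists_injective
    (fun i => (t i).disjSum (Finset.univ : Finset (Fin d)))).1 (by
      intro S
      rcases S.eq_empty_or_nonempty with rfl | ⟨i₀, hi₀⟩
      · simp
      have : S.biUnion (fun i => (t i).disjSum (Finset.univ : Finset (Fin d))) =
          (S.biUnion t).disjSum Finset.univ := by
        ext x
        rcases x with x | x
        · simp
        · simpa using ⟨i₀, hi₀⟩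
      rw [this, Finset.card_disjSum]
      simpa using h S)
  let D : Finset I := Finset.univ.filter fun i => (f i).isLeft
  let g : I → J := fun i => Sum.elim id (fun _ => Classical.arbitrary J) (f i)
  have hD : ∀ i ∈ D, f i = Sum.inl (g i) := by
    intro i hi
    have : (f i).isLeft := by simpa [D] using hi
    obtain ⟨y, hy⟩ := Sum.isLeft_iff.1 this
    simp [g, hy]
  refine ⟨D, g, ?_, ?_, ?_⟩
  · intro i hi j hj hij
    apply hf
    rw [hD i hi, hD j hj, hij]
  · intro i hi
    have := hft i
    rw [hD i hi] at this
    simpa using this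
  · have h1 : (Finset.univ.filter fun i => ¬ (f i).isLeft).card ≤ d := by
      have h2 : ((Finset.univ.filter fun i => ¬ (f i).isLeft).image f).card ≤
          ((Finset.univ : Finset (Fin d)).image (Sum.inr : Fin d → J ⊕ Fin d)).card := by
        apply Finset.card_le_card
        intro x hx
        simp only [Finset.mem_image, Finset.mem_filter, Finset.mem_univ, true_and] at hx ⊢
        obtain ⟨i, hi, rfl⟩ := hx
        rcases hfi : f i with y | y
        · simp [hfi] at hi
        · exact ⟨y, rfl⟩
      rw [Finset.card_image_of_injective _ hf] at h2
      exact h2.trans (Finset.card_image_le.trans (by simp))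
    have h3 := Finset.card_filter_add_card_filter_not (s := (Finset.univ : Finset I))
      (fun i => (f i).isLeft)
    rw [Finset.card_univ] at h3
    change _ ≤ (Finset.univ.filter fun i => (f i).isLeft).card + d
    omega

/-- If the edges of a bipartite graph cover two families of vertices of size `n`, one on each
side, then the number of edges is at least `2 n` minus the matching number of the two families. -/
theorem exists_matching_of_edges {I W A B : Type*} [Fintype I] [Fintype W]
    (α : W → A) (β : W → B) (a : I → A) (b : I → B)
    (ha : Function.Injective a) (hb : Function.Injective b)
    (hα : ∀ i, ∃ w, α w = a i) (hβ : ∀ i, ∃ w, β w = b i) :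
    ∃ (D : Finset I) (σ : I → I), Set.InjOn σ D ∧
      (∀ i ∈ D, ∃ w, α w = a i ∧ β w = b (σ i)) ∧
      2 * Fintype.card I ≤ D.card + Fintype.card W := by
  classical
  rcases isEmpty_or_nonempty I with hI | hI
  · exact ⟨∅, id, by simp, by simp, by simp⟩
  let t : I → Finset I := fun i => Finset.univ.filter fun j => ∃ w, α w = a i ∧ β w = b j
  -- `S` has maximal deficiency, truncated at `0`. If the truncation bites, the defect is `0` and
  -- injectivity of `u` suffices for the count.
  obtain ⟨S, -, hS⟩ := Finset.exists_max_image (Finset.univ : Finset (Finset I))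
    (fun S => S.card - (S.biUnion t).card) ⟨∅, Finset.mem_univ _⟩
  obtain ⟨D, σ, hσ, hσt, hD⟩ := exists_partial_transversal t (S.card - (S.biUnion t).card)
    (fun T => by have := hS T (Finset.mem_univ _); omega)
  refine ⟨D, σ, hσ, fun i hi => by simpa [t] using hσt i hi, ?_⟩
  choose u hu using hα
  choose v hv using hβ
  have huinj : Function.Injective u := fun i j hij => ha (by rw [← hu, ← hu, hij])
  have hvinj : Function.Injective v := fun i j hij => hb (by rw [← hv, ← hv, hij])
  -- An edge issuing from `S` cannot end outside the neighbourhood of `S`, so the two families of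
  -- edges add up.
  have hdisj : Disjoint (S.image u) ((S.biUnion t)ᶜ.image v) := by
    rw [Finset.disjoint_left]
    intro w hw hw'
    simp only [Finset.mem_image, Finset.mem_compl] at hw hw'
    obtain ⟨i, hi, rfl⟩ := hw
    obtain ⟨j, hj, hji⟩ := hw'
    apply hj
    rw [Finset.mem_biUnion]
    refine ⟨i, hi, ?_⟩
    simp only [t, Finset.mem_filter, Finset.mem_univ, true_and]
    exact ⟨u i, hu i, by rw [← hji, hv]⟩
  have hcard := Finset.card_le_univ ((S.image u) ∪ ((S.biUnion t)ᶜ.image v))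
  rw [Finset.card_union_of_disjoint hdisj, Finset.card_image_of_injective _ huinj,
    Finset.card_image_of_injective _ hvinj, Finset.card_compl] at hcard
  have := Finset.card_le_univ (S.biUnion t)
  have := Fintype.card_le_of_injective u huinj
  omega

theorem matchingNumber_bddAbove {α β : Type*} (E : Finset α) (F : Finset β) (R : α → β → Prop) :
    BddAbove {n | ∃ D ⊆ E, ∃ φ : {x // x ∈ D} → β, Function.Injective φ ∧
    (∀ x : {x // x ∈ D}, φ x ∈ F ∧ R x (φ x)) ∧ D.card = n} := by
  refine ⟨E.card, ?_⟩
  rintro n ⟨D, hD, -, -, -, rfl⟩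
  exact Finset.card_le_card hD

theorem matchingNumber_le_card {α β : Type*} (E : Finset α) (F : Finset β) (R : α → β → Prop) :
    matchingNumber E F R ≤ E.card := by
  apply csSup_le'
  rintro n ⟨D, hD, -, -, -, rfl⟩
  exact Finset.card_le_card hD

theorem exists_matching {α β : Type*} (E : Finset α) (F : Finset β) (R : α → β → Prop) :
    ∃ D ⊆ E, ∃ φ : {x // x ∈ D} → β, Function.Injective φ ∧
      (∀ x : {x // x ∈ D}, φ x ∈ F ∧ R x (φ x)) ∧ D.card = matchingNumber E F R := by
  have := Nat.sSup_mem (s := {n | ∃ D ⊆ E, ∃ φ : {x // x ∈ D} → β, Function.Injective φ ∧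
    (∀ x : {x // x ∈ D}, φ x ∈ F ∧ R x (φ x)) ∧ D.card = n})
    ⟨0, ∅, by simp, isEmptyElim, isEmptyElim, isEmptyElim, by simp⟩ (matchingNumber_bddAbove E F R)
  exact this

/-- An indexed form of the lower bound for the matching number of `F` and `gF`. -/
theorem le_coverMatching {X I : Type*} [Fintype I] [DecidableEq X] (p : I → X)
    (hp : Function.Injective p) (g : Equiv.Perm X) (𝒰 : Set (Set X)) (D : Finset I) (σ : I → I)
    (hσ : Set.InjOn σ D) (h : ∀ i ∈ D, ∃ U ∈ 𝒰, p i ∈ U ∧ g (p (σ i)) ∈ U) :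
    D.card ≤ coverMatching (Finset.univ.image p) ((Finset.univ.image p).map g.toEmbedding) 𝒰 := by
  classical
  refine le_csSup (matchingNumber_bddAbove _ _ (fun x y => ∃ U ∈ 𝒰, x ∈ U ∧ y ∈ U)) ?_
  have hex : ∀ x : {x // x ∈ D.image p}, ∃ i ∈ D, p i = x := fun x =>
    Finset.mem_image.1 x.2
  choose k hk hk' using hex
  refine ⟨D.image p, Finset.image_subset_image (Finset.subset_univ _),
    fun x => g (p (σ (k x))), ?_, ?_, Finset.card_image_of_injective _ hp⟩
  · intro x y hxy
    have := hσ (hk x) (hk y) (hp (g.injective hxy))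
    ext
    rw [← hk' x, ← hk' y, this]
  · intro x
    refine ⟨by simp, ?_⟩
    have := h (k x) (hk x)
    rwa [hk' x] at this

/-- An indexed form of the matching number of `F` and `gF`. -/
theorem exists_coverMatching {X : Type*} (F : Finset X) (g : Equiv.Perm X) (𝒰 : Set (Set X)) :
    ∃ (D : Finset {x // x ∈ F}) (σ : {x // x ∈ F} → {x // x ∈ F}), Set.InjOn σ D ∧
      (∀ i ∈ D, ∃ U ∈ 𝒰, (i : X) ∈ U ∧ g (σ i : X) ∈ U) ∧
      D.card = coverMatching F (F.map g.toEmbedding) 𝒰 := by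
  classical
  obtain ⟨D, hD, φ, hφ, hR, hcard⟩ := exists_matching F (F.map g.toEmbedding)
    (fun x y => ∃ U ∈ 𝒰, x ∈ U ∧ y ∈ U)
  have hex : ∀ x : {x // x ∈ D}, ∃ y : {x // x ∈ F}, g y = φ x := fun x => by
    obtain ⟨y, hy, hy'⟩ := Finset.mem_map.1 (hR x).1
    exact ⟨⟨y, hy⟩, hy'⟩
  choose s hs using hex
  let σ : {x // x ∈ F} → {x // x ∈ F} := fun x => if h : (x : X) ∈ D then s ⟨x, h⟩ else x
  have hσ : ∀ x : {x // x ∈ F}, ∀ h : (x : X) ∈ D, σ x = s ⟨x, h⟩ := fun x h => by simp [σ, h]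
  refine ⟨Finset.univ.filter fun x => (x : X) ∈ D, σ, ?_, ?_, ?_⟩
  · intro x hx y hy hxy
    simp only [Finset.coe_filter, Finset.mem_univ, true_and, mem_ofPred_eq] at hx hy
    rw [hσ x hx, hσ y hy] at hxy
    have := hφ ((hs _).symm.trans ((congrArg (fun z : {x // x ∈ F} => g z) hxy).trans (hs _)))
    exact Subtype.ext (congrArg (fun z : {x // x ∈ D} => (z : X)) this)
  · intro x hx
    simp only [Finset.mem_filter, Finset.mem_univ, true_and] at hx
    rw [hσ x hx, hs]
    exact (hR ⟨x, hx⟩).2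
  · rw [← Finset.card_map (Function.Embedding.subtype _)]
    refine Eq.trans (congrArg Finset.card ?_) hcard
    ext x
    simpa using fun h => hD h

/-! ### Uniformly continuous functions and finite uniform coverings -/

/-- Every entourage contains a ball of some uniformly continuous pseudometric. -/
theorem exists_uniform_pseudometric {X : Type*} [UniformSpace X] {W : Set (X × X)}
    (hW : W ∈ 𝓤 X) :
    ∃ d : PseudoMetricSpace X, (∀ ε > 0, {p : X × X | d.dist p.1 p.2 < ε} ∈ 𝓤 X) ∧
      ∃ δ > 0, ∀ x y, d.dist x y < δ → (x, y) ∈ W := by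
  have key : ∀ V : {V : SetRel X X // V ∈ 𝓤 X}, ∃ V' : {V : SetRel X X // V ∈ 𝓤 X},
      (∀ x y, (x, y) ∈ V'.1 → (y, x) ∈ V'.1) ∧
      (∀ x y z, (x, y) ∈ V'.1 → (y, z) ∈ V'.1 → (x, z) ∈ V.1) := by
    rintro ⟨V, hV⟩
    obtain ⟨t, ht, hts, htV⟩ := comp_symm_mem_uniformity_sets hV
    exact ⟨⟨t, ht⟩, fun x y h => hts.symm _ _ h, fun x y z h h' => htV ⟨y, h, h'⟩⟩
  choose next hsymm hcomp using key
  -- These entourages generate a coarser, countably generated uniformity, which is therefore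
  -- pseudometrizable. Starting at `next W` makes `S 0` symmetric too.
  let S : ℕ → {V : SetRel X X // V ∈ 𝓤 X} := fun n => next^[n] (next ⟨W, hW⟩)
  have hS : ∀ n, S (n + 1) = next (S n) := fun n => Function.iterate_succ_apply' _ _ _
  have hSs : ∀ n x y, (x, y) ∈ (S n).1 → (y, x) ∈ (S n).1 := by
    intro n
    cases n with
    | zero => exact hsymm _
    | succ n => rw [hS]; exact hsymm _
  have hSr : ∀ n x, (x, x) ∈ (S n).1 := fun n x => refl_mem_uniformity (S n).2
  have hSc : ∀ n x y z, (x, y) ∈ (S (n + 1)).1 → (y, z) ∈ (S (n + 1)).1 → (x, z) ∈ (S n).1 := by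
    intro n
    rw [hS]
    exact hcomp _
  have hanti : Antitone fun n => (S n).1 := antitone_nat_of_succ_le fun n p hp =>
    hSc n p.1 p.1 p.2 (hSr _ _) hp
  have hbasis : (⨅ n, Filter.principal (S n).1).HasBasis (fun _ => True) fun n => (S n).1 :=
    Filter.hasBasis_iInf_principal hanti.directed_ge
  let u : UniformSpace X := UniformSpace.ofCore
    { uniformity := ⨅ n, Filter.principal (S n).1
      refl := by
        rw [le_iInf_iff]
        intro n
        rw [Filter.principal_mono]
        rintro ⟨x, y⟩ h
        obtain rfl : x = y := by simpa using h
        exact hSr n x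
      symm := by
        rw [hbasis.tendsto_iff hbasis]
        exact fun n _ => ⟨n, trivial, fun p hp => hSs n _ _ hp⟩
      comp := by
        refine (hbasis.lift' (fun _ _ h => SetRel.comp_subset_comp h h)).le_basis_iff hbasis |>.2 ?_
        rintro n -
        exact ⟨n + 1, trivial, fun p ⟨y, h1, h2⟩ => hSc n _ _ _ h1 h2⟩ }
  have hu : 𝓤[u] = ⨅ n, Filter.principal (S n).1 := rfl
  have hcg : (𝓤[u]).IsCountablyGenerated := by
    rw [hu]; infer_instance
  obtain ⟨d, hd⟩ := @UniformSpace.metrizable_uniformity X u hcg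
  refine ⟨d, fun ε hε => ?_, ?_⟩
  · have h1 : {p : X × X | d.dist p.1 p.2 < ε} ∈ 𝓤[u] := by
      rw [← hd]
      exact @Metric.dist_mem_uniformity X d ε hε
    rw [hu] at h1
    obtain ⟨n, -, hn⟩ := hbasis.mem_iff.1 h1
    exact Filter.mem_of_superset (S n).2 hn
  · have h1 : W ∈ 𝓤[u] := by
      rw [hu]
      refine hbasis.mem_iff.2 ⟨0, trivial, fun p hp => ?_⟩
      exact hcomp ⟨W, hW⟩ p.1 p.1 p.2 (hSr 0 p.1) hp
    rw [← hd] at h1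
    obtain ⟨δ, hδ, h⟩ := (@Metric.mem_uniformity_dist X d W).1 h1
    exact ⟨δ, hδ, fun x y hxy => h hxy⟩

/-- Urysohn functions of a uniform covering: each point is in the set `{h U = 1}` of some
member `U`. -/
theorem IsUniformCovering.exists_urysohn {X : Type*} [UniformSpace X] {𝒰 : Set (Set X)}
    (h𝒰 : IsUniformCovering 𝒰) :
    ∃ h : Set X → X → ℝ, (∀ U, UniformContinuous (h U)) ∧ (∀ U x, 0 ≤ h U x) ∧
      (∀ U x, h U x ≤ 1) ∧ (∀ U x, 0 < h U x → x ∈ U) ∧ ∀ x, ∃ U ∈ 𝒰, h U x = 1 := by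
  obtain ⟨W, hW, hWU⟩ := h𝒰
  obtain ⟨d, hd, δ, hδ, hdW⟩ := exists_uniform_pseudometric hW
  classical
  let f : Set X → X → ℝ := fun U x =>
    -- `Metric.infDist` to the empty set is `0`, so the whole space needs its own clause.
    if U = univ then 1 else min 1 (@Metric.infDist X d x Uᶜ / δ)
  have hf : ∀ U x, U ≠ univ → f U x = min 1 (@Metric.infDist X d x Uᶜ / δ) :=
    fun U x hU => if_neg hU
  have hf1 : ∀ x, f univ x = 1 := fun x => if_pos rfl
  refine ⟨f, fun U => ?_, fun U x => ?_, fun U x => ?_, fun U x hx => ?_, fun x => ?_⟩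
  · by_cases hU : U = univ
    · subst hU
      simpa [funext hf1] using uniformContinuous_const
    · refine Metric.uniformity_basis_dist.tendsto_right_iff.2 fun ε hε => ?_
      refine Filter.mem_of_superset (hd (ε * δ) (by positivity)) fun p hp => ?_
      have h1 := @Metric.infDist_le_infDist_add_dist X d Uᶜ p.1 p.2
      have h2 := @Metric.infDist_le_infDist_add_dist X d Uᶜ p.2 p.1
      rw [d.dist_comm] at h2
      have h3 : |@Metric.infDist X d p.1 Uᶜ - @Metric.infDist X d p.2 Uᶜ| ≤ d.dist p.1 p.2 :=
        abs_sub_le_iff.2 ⟨by linarith, by linarith⟩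
      change dist (f U p.1) (f U p.2) < ε
      rw [hf _ _ hU, hf _ _ hU, Real.dist_eq]
      refine (abs_min_sub_min_le_max _ _ _ _).trans_lt ?_
      rw [sub_self, abs_zero, ← sub_div, abs_div, abs_of_pos hδ]
      refine max_lt hε ?_
      rw [div_lt_iff₀ hδ]
      exact h3.trans_lt hp
  · by_cases hU : U = univ
    · subst hU; rw [hf1]; norm_num
    · rw [hf _ _ hU]
      exact le_min zero_le_one (div_nonneg (@Metric.infDist_nonneg X d _ _) hδ.le)
  · by_cases hU : U = univ
    · subst hU; rw [hf1]
    · rw [hf _ _ hU]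
      exact min_le_left _ _
  · by_contra hxU
    have hU : U ≠ univ := fun h => hxU (h ▸ mem_univ x)
    rw [hf _ _ hU, @Metric.infDist_zero_of_mem X d _ _ hxU] at hx
    simp at hx
  · obtain ⟨U, hU, hxU⟩ := hWU x
    refine ⟨U, hU, ?_⟩
    by_cases hU' : U = univ
    · subst hU'; rw [hf1]
    · rw [hf _ _ hU', min_eq_left]
      rw [le_div_iff₀ hδ, one_mul]
      refine (@Metric.le_infDist X d _ _ _ (nonempty_compl.2 hU')).2 fun {y} hy => ?_
      by_contra hlt
      exact hy (hxU (hdW x y (not_le.1 hlt)))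

/-- A bounded uniformly continuous map to `ℝⁿ` has small oscillation on the members of
a suitable finite uniform covering. -/
theorem exists_finUnifCov_dist_lt {X ι : Type*} [UniformSpace X] [Fintype ι] (Φ : X → ι → ℝ)
    (hΦ : UniformContinuous Φ) (C : ℝ) (hC : ∀ x i, |Φ x i| ≤ C) {ε : ℝ} (hε : 0 < ε) :
    ∃ 𝒰 ∈ finUnifCov X, ∀ U ∈ 𝒰, ∀ x ∈ U, ∀ y ∈ U, dist (Φ x) (Φ y) < ε := by
  have hb : TotallyBounded (range Φ) := by
    refine ((isCompact_closedBall (0 : ι → ℝ) |C|).totallyBounded).subset ?_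
    rintro _ ⟨x, rfl⟩
    rw [mem_closedBall_zero_iff, pi_norm_le_iff_of_nonneg (abs_nonneg _)]
    exact fun i => (hC x i).trans (le_abs_self C)
  -- Doubling the radius of the balls of this net to `ε / 2` leaves room for a whole `ε / 4`-ball
  -- around each point, while diameters stay below `ε`.
  obtain ⟨t, ht, hcov⟩ := Metric.totallyBounded_iff.1 hb (ε / 4) (by positivity)
  refine ⟨(fun c => Φ ⁻¹' Metric.ball c (ε / 2)) '' t, ⟨ht.image _, ?_⟩, ?_⟩
  · refine ⟨_, hΦ (Metric.dist_mem_uniformity (show 0 < ε / 4 by positivity)), fun x => ?_⟩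
    obtain ⟨c, hc, hxc⟩ := mem_iUnion₂.1 (hcov (mem_range_self x))
    refine ⟨_, mem_image_of_mem _ hc, fun y hy => ?_⟩
    have h1 : dist (Φ x) (Φ y) < ε / 4 := hy
    have h2 : dist (Φ x) c < ε / 4 := hxc
    have := dist_triangle_left (Φ y) c (Φ x)
    change dist (Φ y) c < ε / 2
    linarith
  · rintro _ ⟨c, -, rfl⟩ x hx y hy
    have h1 : dist (Φ x) c < ε / 2 := hx
    have h2 : dist (Φ y) c < ε / 2 := hy
    have := dist_triangle_right (Φ x) (Φ y) c
    linarith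

/-! ### Complexity -/

theorem complexity_le {X : Type*} [UniformSpace X] {𝒰 𝒱 : Set (Set X)} (h𝒱 : 𝒱 ∈ finUnifCov X)
    (h : Refines 𝒰 𝒱) : complexity 𝒰 ≤ 𝒱.ncard :=
  Nat.sInf_le ⟨𝒱, h𝒱, h, rfl⟩

theorem Refines.refl {X : Type*} (𝒰 : Set (Set X)) : Refines 𝒰 𝒰 := fun U hU => ⟨U, hU, le_rfl⟩

theorem Refines.trans {X : Type*} {𝒰 𝒱 𝒲 : Set (Set X)} (h : Refines 𝒰 𝒱) (h' : Refines 𝒱 𝒲) :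
    Refines 𝒰 𝒲 := fun W hW => by
  obtain ⟨V, hV, hWV⟩ := h' W hW
  obtain ⟨U, hU, hVU⟩ := h V hV
  exact ⟨U, hU, hWV.trans hVU⟩

theorem exists_ncard_eq_complexity {X : Type*} [UniformSpace X] {𝒰 : Set (Set X)}
    (h𝒰 : 𝒰 ∈ finUnifCov X) :
    ∃ 𝒱 ∈ finUnifCov X, Refines 𝒰 𝒱 ∧ 𝒱.ncard = complexity 𝒰 :=
  Nat.sInf_mem (s := {n | ∃ 𝒱 ∈ finUnifCov X, Refines 𝒰 𝒱 ∧ 𝒱.ncard = n})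
    ⟨_, 𝒰, h𝒰, Refines.refl 𝒰, rfl⟩

theorem IsUniformCovering.exists_mem {X : Type*} [UniformSpace X] {𝒰 : Set (Set X)}
    (h𝒰 : IsUniformCovering 𝒰) (x : X) : ∃ U ∈ 𝒰, x ∈ U := by
  obtain ⟨W, hW, h⟩ := h𝒰
  obtain ⟨U, hU, hx⟩ := h x
  exact ⟨U, hU, hx (refl_mem_uniformity hW)⟩

theorem complexity_pos {X : Type*} [UniformSpace X] [Nonempty X] {𝒰 : Set (Set X)}
    (h𝒰 : 𝒰 ∈ finUnifCov X) : 0 < complexity 𝒰 := by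
  obtain ⟨𝒱, h𝒱, -, hcard⟩ := exists_ncard_eq_complexity h𝒰
  obtain ⟨U, hU, -⟩ := h𝒱.2.exists_mem (Classical.arbitrary X)
  rw [← hcard]
  exact (ncard_pos h𝒱.1).2 ⟨U, hU⟩

/-- The members of a uniform covering of minimal cardinality are non-empty. -/
theorem nonempty_of_ncard_le_complexity {X : Type*} [UniformSpace X] [Nonempty X]
    {𝒰 𝒱 : Set (Set X)} (h𝒱 : 𝒱 ∈ finUnifCov X) (h : Refines 𝒰 𝒱)
    (hcard : 𝒱.ncard ≤ complexity 𝒰) {V : Set X} (hV : V ∈ 𝒱) : V.Nonempty := by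
  by_contra hne
  rw [not_nonempty_iff_eq_empty] at hne
  subst hne
  have h1 : 𝒱 \ {∅} ∈ finUnifCov X := by
    obtain ⟨hfin, W, hW, hWV⟩ := h𝒱
    refine ⟨hfin.subset sdiff_subset, W, hW, fun x => ?_⟩
    obtain ⟨V, hV, hx⟩ := hWV x
    refine ⟨V, ⟨hV, ?_⟩, hx⟩
    rintro rfl
    exact hx (refl_mem_uniformity hW)
  have h2 := complexity_le h1 (fun V hV => h V hV.1)
  have h3 := ncard_sdiff_singleton_lt_of_mem hV h𝒱.1
  omega

/-- Let `𝒱'` be a refinement of `𝒱` of minimal cardinality, and let `𝒲` be another uniform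
covering refining `𝒱`, with `W ⊆ α W ∈ 𝒱`. Then there is an injective choice of members of `𝒱`
of the form `α W` with `W` meeting the given member of `𝒱'`. -/
theorem exists_injective_of_minimal {X : Type*} [UniformSpace X] {𝒱 𝒱' 𝒲 : Set (Set X)}
    (h𝒱' : 𝒱' ∈ finUnifCov X) (h𝒲 : 𝒲 ∈ finUnifCov X) (hr : Refines 𝒱 𝒱')
    (hcard : 𝒱'.ncard ≤ complexity 𝒱)
    (α : 𝒲 → Set X) (hα : ∀ W, α W ∈ 𝒱) (hWα : ∀ W : 𝒲, (W : Set X) ⊆ α W) :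
    ∃ a : 𝒱' → Set X, Function.Injective a ∧
      ∀ V, ∃ W : 𝒲, α W = a V ∧ ((W : Set X) ∩ V).Nonempty := by
  classical
  have := h𝒱'.1.fintype
  have := h𝒲.1.fintype
  let t : 𝒱' → Finset (Set X) := fun V =>
    (Finset.univ.filter fun W : 𝒲 => ((W : Set X) ∩ V).Nonempty).image α
  obtain ⟨a, ha, hat⟩ := (Finset.all_card_le_biUnion_card_iff_exists_injective t).1 (by
    intro S
    by_contra hlt
    rw [not_le] at hlt
    let A : Set X → Set X := fun V => ⋃ (W : 𝒲) (_ : α W = V), (W : Set X)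
    -- If Hall's condition fails at `S`, exchange the members of `𝒱'` in `S` for the fewer unions `A
    -- V`: the result is still a uniform covering refining `𝒱`, against minimality.
    let 𝒵 : Finset (Set X) := (Sᶜ.image (fun V : 𝒱' => (V : Set X))) ∪ (S.biUnion t).image A
    have h𝒵 : (𝒵 : Set (Set X)) ∈ finUnifCov X := by
      refine ⟨𝒵.finite_toSet, ?_⟩
      obtain ⟨-, R, hR, hRV⟩ := h𝒱'
      obtain ⟨-, R', hR', hRW⟩ := h𝒲
      refine ⟨R ∩ R', Filter.inter_mem hR hR', fun x => ?_⟩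
      obtain ⟨V, hV, hxV⟩ := hRV x
      obtain ⟨W, hW, hxW⟩ := hRW x
      by_cases hS : (⟨V, hV⟩ : 𝒱') ∈ S
      · refine ⟨A (α ⟨W, hW⟩), ?_, fun y hy => ?_⟩
        · rw [Finset.mem_coe, Finset.mem_union]
          right
          refine Finset.mem_image_of_mem _ (Finset.mem_biUnion.2 ⟨_, hS, ?_⟩)
          refine Finset.mem_image_of_mem _ ?_
          simp only [Finset.mem_filter, Finset.mem_univ, true_and]
          exact ⟨x, hxW (refl_mem_uniformity hR'), hxV (refl_mem_uniformity hR)⟩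
        · exact mem_iUnion₂.2 ⟨⟨W, hW⟩, rfl, hxW hy.2⟩
      · refine ⟨V, ?_, fun y hy => hxV hy.1⟩
        rw [Finset.mem_coe, Finset.mem_union]
        left
        exact Finset.mem_image.2 ⟨⟨V, hV⟩, by simpa using hS, rfl⟩
    have h𝒱𝒵 : Refines 𝒱 (𝒵 : Set (Set X)) := by
      intro Z hZ
      rw [Finset.mem_coe, Finset.mem_union] at hZ
      rcases hZ with hZ | hZ
      · obtain ⟨V, -, rfl⟩ := Finset.mem_image.1 hZ
        exact hr V V.2
      · obtain ⟨V, hV, rfl⟩ := Finset.mem_image.1 hZ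
        obtain ⟨V', -, hV'⟩ := Finset.mem_biUnion.1 hV
        obtain ⟨W, -, rfl⟩ := Finset.mem_image.1 hV'
        refine ⟨_, hα W, iUnion₂_subset fun W' hW' => ?_⟩
        rw [← hW']
        exact hWα W'
    have h1 := complexity_le h𝒵 h𝒱𝒵
    rw [ncard_coe_finset] at h1
    have h2 : 𝒵.card ≤ Sᶜ.card + (S.biUnion t).card :=
      (Finset.card_union_le _ _).trans (add_le_add Finset.card_image_le Finset.card_image_le)
    rw [Finset.card_compl] at h2
    have h3 : 𝒱'.ncard = Fintype.card 𝒱' := by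
      rw [← Nat.card_coe_set_eq, Nat.card_eq_fintype_card]
    have h4 := Finset.card_le_univ S
    omega)
  refine ⟨a, ha, fun V => ?_⟩
  obtain ⟨W, hW, hWa⟩ := Finset.mem_image.1 (hat V)
  exact ⟨W, hWa, by simpa using hW⟩

/-! ### Operations on uniform coverings -/

theorem join_mem_finUnifCov {X : Type*} [UniformSpace X] {𝒰 𝒱 : Set (Set X)}
    (h𝒰 : 𝒰 ∈ finUnifCov X) (h𝒱 : 𝒱 ∈ finUnifCov X) : join 𝒰 𝒱 ∈ finUnifCov X := by
  obtain ⟨hU, R, hR, hRU⟩ := h𝒰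
  obtain ⟨hV, S, hS, hSV⟩ := h𝒱
  refine ⟨(hU.image2 (· ∩ ·) hV).subset ?_, R ∩ S, Filter.inter_mem hR hS, fun x => ?_⟩
  · rintro _ ⟨U, hU, V, hV, rfl⟩
    exact ⟨U, hU, V, hV, rfl⟩
  · obtain ⟨U, hU, hxU⟩ := hRU x
    obtain ⟨V, hV, hxV⟩ := hSV x
    exact ⟨_, ⟨U, hU, V, hV, rfl⟩, fun y hy => ⟨hxU hy.1, hxV hy.2⟩⟩

theorem imageFamily_mem_finUnifCov {X : Type*} [UniformSpace X] {𝒰 : Set (Set X)}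
    (h𝒰 : 𝒰 ∈ finUnifCov X) (g : Equiv.Perm X) (hg : UniformContinuous g.symm) :
    imageFamily g 𝒰 ∈ finUnifCov X := by
  obtain ⟨hU, R, hR, hRU⟩ := h𝒰
  refine ⟨hU.image _, _, hg hR, fun x => ?_⟩
  obtain ⟨U, hU, hxU⟩ := hRU (g.symm x)
  refine ⟨_, mem_image_of_mem _ hU, fun y hy => ⟨g.symm y, hxU hy, by simp⟩⟩

theorem IsUniformCovering.exists_mem_nhds {X : Type*} [UniformSpace X] {𝒰 : Set (Set X)}
    (h𝒰 : IsUniformCovering 𝒰) (x : X) : ∃ U ∈ 𝒰, U ∈ 𝓝 x := by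
  obtain ⟨W, hW, h⟩ := h𝒰
  obtain ⟨U, hU, hx⟩ := h x
  exact ⟨U, hU, Filter.mem_of_superset (UniformSpace.ball_mem_nhds x hW) hx⟩

theorem refines_join_left {X : Type*} (𝒰 𝒱 : Set (Set X)) : Refines 𝒰 (join 𝒰 𝒱) := by
  rintro _ ⟨U, hU, V, -, rfl⟩
  exact ⟨U, hU, inter_subset_left⟩

/-- If the members of a finite uniform covering are punctured at finitely many points and
neighbourhoods of these points are added, the result is again a uniform covering. -/
theorem IsUniformCovering.punctured {X : Type*} [UniformSpace X] {𝒰 𝒜 : Set (Set X)}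
    (h𝒰 : IsUniformCovering 𝒰) {F : Set X} (hF : F.Finite) (h𝒜 : ∀ x ∈ F, ∃ A ∈ 𝒜, A ∈ 𝓝 x) :
    IsUniformCovering (𝒜 ∪ (fun U => U \ F) '' 𝒰) := by
  obtain ⟨R, hR, hRU⟩ := h𝒰
  have hx : ∀ x : X, ∃ T ∈ 𝓤 X, x ∈ F → ∃ A ∈ 𝒜,
      ∀ y z, (x, y) ∈ T → (y, z) ∈ T → z ∈ A := by
    intro x
    by_cases hxF : x ∈ F
    · obtain ⟨A, hA, hAx⟩ := h𝒜 x hxF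
      obtain ⟨S, hS, hSA⟩ := UniformSpace.mem_nhds_iff.1 hAx
      obtain ⟨T, hT, hTS⟩ := comp_mem_uniformity_sets hS
      exact ⟨T, hT, fun _ => ⟨A, hA, fun y z h1 h2 => hSA (hTS ⟨y, h1, h2⟩)⟩⟩
    · exact ⟨univ, Filter.univ_mem, fun h => absurd h hxF⟩
  choose T hT hTA using hx
  obtain ⟨S, hS, hSsymm, hSsub⟩ := symm_of_uniformity
    (Filter.inter_mem hR ((Filter.biInter_mem hF).2 fun x _ => hT x))
  refine ⟨S, hS, fun z => ?_⟩
  -- A ball containing some `x ∈ F` lies in the chosen neighbourhood of `x`; a ball missing `F` lies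
  -- in some `U \ F`.
  by_cases hz : ∃ x ∈ F, (z, x) ∈ S
  · obtain ⟨x, hxF, hzx⟩ := hz
    obtain ⟨A, hA, hAT⟩ := hTA x hxF
    refine ⟨A, Or.inl hA, fun y hy => hAT z y ?_ ?_⟩
    · exact mem_iInter₂.1 (hSsub (hSsymm.symm _ _ hzx)).2 x hxF
    · exact mem_iInter₂.1 (hSsub hy).2 x hxF
  · obtain ⟨U, hU, hzU⟩ := hRU z
    exact ⟨_, Or.inr (mem_image_of_mem _ hU), fun y hy => ⟨hzU (hSsub hy).1,
      fun hyF => hz ⟨y, hyF, hy⟩⟩⟩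

/-! ### General position in groups and the two estimates between complexity and matchings. -/

section Group

attribute [local instance] IsTopologicalGroup.rightUniformSpace

variable {G : Type*} [Group G] [TopologicalSpace G] [IsTopologicalGroup G]

/-- By homogeneity an isolated point would make the identity isolated. This is where
non-discreteness enters: points can always be perturbed. -/
theorem infinite_of_mem_nhds_of_not_discrete [T1Space G] (hG : ¬ DiscreteTopology G) {x : G}
    {O : Set G} (hO : O ∈ 𝓝 x) : O.Infinite := by
  have : (𝓝[≠] x).NeBot := by
    refine ⟨fun h => hG (discreteTopology_of_isOpen_singleton_one ?_)⟩
    have h1 := ((isOpen_singleton_iff_punctured_nhds x).2 h).preimage (continuous_const_mul x)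
    convert h1 using 1
    ext y
    simp
  exact infinite_of_mem_nhds x hO

/-- In a non-discrete group, finitely many points can be moved slightly into general position. -/
theorem exists_generic [T1Space G] (hG : ¬ DiscreteTopology G) {I : Type*} [Finite I]
    (x : I → G) (O : I → Set G) (hO : ∀ i, O i ∈ 𝓝 (x i)) (K : Finset G) :
    ∃ p : I → G, (∀ i, p i ∈ O i) ∧ ∀ i j, i ≠ j → ∀ k ∈ K, p i ≠ k * p j := by
  classical
  have := Fintype.ofFinite I
  suffices h : ∀ s : Finset I, ∃ p : I → G, (∀ i, p i ∈ O i) ∧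
      ∀ i ∈ s, ∀ j ∈ s, i ≠ j → ∀ k ∈ K, p i ≠ k * p j by
    obtain ⟨p, hp, hp'⟩ := h Finset.univ
    exact ⟨p, hp, fun i j => hp' i (Finset.mem_univ i) j (Finset.mem_univ j)⟩
  intro s
  induction s using Finset.induction_on with
  | empty => exact ⟨x, fun i => mem_of_mem_nhds (hO i), by simp⟩
  | insert i₀ s hi₀ ih =>
    obtain ⟨p, hp, hp'⟩ := ih
    let bad : Finset G := (K ×ˢ s).image (fun q => q.1 * p q.2) ∪
      (K ×ˢ s).image (fun q => q.1⁻¹ * p q.2)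
    obtain ⟨q, hq, hqbad⟩ :=
      (infinite_of_mem_nhds_of_not_discrete hG (hO i₀)).exists_notMem_finset bad
    have hbad : ∀ j ∈ s, ∀ k ∈ K, q ≠ k * p j ∧ p j ≠ k * q := by
      intro j hj k hk
      constructor
      · rintro rfl
        exact hqbad (Finset.mem_union_left _ (Finset.mem_image.2
          ⟨(k, j), Finset.mem_product.2 ⟨hk, hj⟩, rfl⟩))
      · intro h
        exact hqbad (Finset.mem_union_right _ (Finset.mem_image.2
          ⟨(k, j), Finset.mem_product.2 ⟨hk, hj⟩, by simp [h]⟩))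
    have hne : ∀ j ∈ s, j ≠ i₀ := fun j hj h => hi₀ (h ▸ hj)
    refine ⟨Function.update p i₀ q, fun i => ?_, fun i hi j hj hij k hk => ?_⟩
    · by_cases h : i = i₀
      · subst h; simpa using hq
      · simpa [h] using hp i
    · rw [Finset.mem_insert] at hi hj
      rcases hi with rfl | hi <;> rcases hj with rfl | hj
      · exact absurd rfl hij
      · simpa [hne j hj] using (hbad j hj k hk).1
      · simpa [hne i hi] using (hbad i hi k hk).2
      · simpa [hne i hi, hne j hj] using hp' i hi j hj hij k hk

/-- Finitely many functions with values in `[0, 1]` and their translates have small oscillation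
on the members of a suitable finite uniform covering. -/
theorem exists_finUnifCov_abs_sub_lt {𝒰 : Set (Set G)} (h𝒰 : 𝒰.Finite) {h : Set G → G → ℝ}
    (hc : ∀ U, UniformContinuous (h U)) (h0 : ∀ U x, 0 ≤ h U x) (h1 : ∀ U x, h U x ≤ 1)
    (K : Finset G) {δ : ℝ} (hδ : 0 < δ) :
    ∃ 𝒱 ∈ finUnifCov G, ∀ V ∈ 𝒱, ∀ x ∈ V, ∀ y ∈ V, ∀ g ∈ K, ∀ U ∈ 𝒰,
      |h U (g * x) - h U (g * y)| < δ := by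
  have := h𝒰.fintype
  obtain ⟨𝒱, h𝒱, hosc⟩ := exists_finUnifCov_dist_lt
    (fun (x : G) (i : 𝒰 × K) => h i.1 (i.2 * x))
    (uniformContinuous_pi.2 fun i => (hc i.1).comp (uniformContinuous_leftMul G _)) 1
    (fun x i => by rw [abs_of_nonneg (h0 _ _)]; exact h1 _ _) hδ
  refine ⟨𝒱, h𝒱, fun V hV x hx y hy g hg U hU => ?_⟩
  have := (dist_pi_lt_iff hδ).1 (hosc V hV x hx y hy) (⟨U, hU⟩, ⟨g, hg⟩)
  rwa [Real.dist_eq] at this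

/-- Bounds the error made when `x` is moved into general position. -/
theorem eventually_abs_sub_lt {𝒰 : Set (Set G)} (h𝒰 : 𝒰.Finite) {h : Set G → G → ℝ}
    (hc : ∀ U, UniformContinuous (h U)) (K : Finset G) {δ : ℝ} (hδ : 0 < δ) (x : G) :
    {p | ∀ g ∈ K, ∀ U ∈ 𝒰, |h U (g * p) - h U (g * x)| < δ} ∈ 𝓝 x := by
  change ∀ᶠ p in 𝓝 x, ∀ g ∈ K, ∀ U ∈ 𝒰, |h U (g * p) - h U (g * x)| < δ
  rw [Filter.eventually_all_finset]
  intro g _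
  rw [Filter.eventually_all_finite h𝒰]
  intro U _
  have hcont : Continuous fun p => h U (g * p) :=
    (hc U).continuous.comp (continuous_const.mul continuous_id)
  have := (Metric.tendsto_nhds.1 (hcont.tendsto x)) δ hδ
  simpa only [Real.dist_eq] using this

/-- For sufficiently fine coverings `𝒱`, the complexity of `𝒱 ∨ g(𝒱)` is bounded from below in
terms of a matching number. -/
theorem exists_le_coverMatching_add_complexity [T1Space G] (hG : ¬ DiscreteTopology G)
    {𝒰 : Set (Set G)} (h𝒰 : 𝒰 ∈ finUnifCov G) (E : Finset G) :
    ∃ 𝒰' ∈ finUnifCov G, ∀ 𝒱 ∈ finUnifCov G, Refines 𝒰' 𝒱 →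
      ∃ F : Finset G, F.card = complexity 𝒱 ∧ ∀ g ∈ E,
        2 * F.card ≤ coverMatching F (F.map (Equiv.mulLeft g).toEmbedding) 𝒰 +
          complexity (join 𝒱 (imageFamily (Equiv.mulLeft g) 𝒱)) := by
  classical
  obtain ⟨h, hc, h0, h1, hpos, hone⟩ := h𝒰.2.exists_urysohn
  obtain ⟨𝒰', h𝒰', hosc⟩ := exists_finUnifCov_abs_sub_lt h𝒰.1 hc h0 h1 (insert 1 E)
    (show (0 : ℝ) < 1 / 6 by norm_num)
  refine ⟨𝒰', h𝒰', fun 𝒱 h𝒱 hr => ?_⟩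
  have hosc' : ∀ V ∈ 𝒱, ∀ x ∈ V, ∀ y ∈ V, ∀ g ∈ insert 1 E, ∀ U ∈ 𝒰,
      |h U (g * x) - h U (g * y)| < 1 / 6 := by
    intro V hV x hx y hy
    obtain ⟨V', hV', hVV'⟩ := hr V hV
    exact hosc V' hV' x (hVV' hx) y (hVV' hy)
  obtain ⟨𝒱', h𝒱', hr', hcard'⟩ := exists_ncard_eq_complexity h𝒱
  have := h𝒱'.1.fintype
  have hn : Fintype.card 𝒱' = complexity 𝒱 := by
    rw [← hcard', ← Nat.card_coe_set_eq, Nat.card_eq_fintype_card]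
  have hne : ∀ V : 𝒱', ∃ x, x ∈ (V : Set G) := fun V =>
    nonempty_of_ncard_le_complexity h𝒱' hr' hcard'.le V.2
  choose v hv using hne
  obtain ⟨p, hpO, hpgen⟩ := exists_generic hG v _
    (fun V => eventually_abs_sub_lt h𝒰.1 hc (insert 1 E) (show (0 : ℝ) < 1 / 6 by norm_num) (v V))
    {1}
  have hpinj : Function.Injective p := fun i j hij => by
    by_contra hne
    exact hpgen i j hne 1 (by simp) (by simpa using hij)
  refine ⟨Finset.univ.image p, by rw [Finset.card_image_of_injective _ hpinj, ← hn]; rfl,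
    fun g hg => ?_⟩
  have h𝒥 := join_mem_finUnifCov h𝒱 (imageFamily_mem_finUnifCov h𝒱 (Equiv.mulLeft g)
    (uniformContinuous_leftMul G g⁻¹))
  obtain ⟨𝒲, h𝒲, hr𝒲, hcard𝒲⟩ := exists_ncard_eq_complexity h𝒥
  have := h𝒲.1.fintype
  have hm : Fintype.card 𝒲 = complexity (join 𝒱 (imageFamily (Equiv.mulLeft g) 𝒱)) := by
    rw [← hcard𝒲, ← Nat.card_coe_set_eq, Nat.card_eq_fintype_card]
  -- Here each `W` becomes an edge between two copies of `𝒱`.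
  have hαβ : ∀ W : 𝒲, ∃ V ∈ 𝒱, ∃ V' ∈ 𝒱, (W : Set G) ⊆ V ∧ ∀ x ∈ (W : Set G), g⁻¹ * x ∈ V' := by
    intro W
    obtain ⟨-, ⟨V, hV, -, ⟨V', hV', rfl⟩, rfl⟩, hW⟩ := hr𝒲 W W.2
    refine ⟨V, hV, V', hV', fun x hx => (hW hx).1, fun x hx => ?_⟩
    obtain ⟨y, hy, rfl⟩ := (hW hx).2
    simpa using hy
  choose α hα β hβ hWα hWβ using hαβ
  obtain ⟨a, ha, haW⟩ := exists_injective_of_minimal h𝒱' h𝒲 hr' hcard'.le α hα hWα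
  let T : Equiv.Perm G := Equiv.mulLeft g⁻¹
  have hTinj : Function.Injective fun W : Set G => T '' W := T.injective.image_injective
  let eW : 𝒲 ≃ imageFamily T 𝒲 := Equiv.Set.image _ 𝒲 hTinj
  have heW : ∀ W, (eW W : Set G) = T '' W := fun W => rfl
  -- The second side is handled by the same exchange argument for the translated covering `g⁻¹𝒲`,
  -- which refines `𝒱` through `β`.
  obtain ⟨b, hb, hbW⟩ := exists_injective_of_minimal h𝒱'
    (imageFamily_mem_finUnifCov h𝒲 T (uniformContinuous_leftMul G g⁻¹⁻¹)) hr' hcard'.le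
    (fun W => β (eW.symm W)) (fun W => hβ _) (fun W => by
      obtain ⟨W, rfl⟩ := eW.surjective W
      rw [heW, Equiv.symm_apply_apply]
      rintro _ ⟨x, hx, rfl⟩
      exact hWβ W x hx)
  have hbW' : ∀ V, ∃ W : 𝒲, β W = b V ∧ ∃ x ∈ (W : Set G), g⁻¹ * x ∈ (V : Set G) := by
    intro V
    obtain ⟨W, hW, y, hy, hyV⟩ := hbW V
    obtain ⟨W, rfl⟩ := eW.surjective W
    rw [Equiv.symm_apply_apply] at hW
    rw [heW] at hy
    obtain ⟨x, hx, rfl⟩ := hy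
    exact ⟨W, hW, x, hx, hyV⟩
  obtain ⟨D, σ, hσ, hD, hcount⟩ := exists_matching_of_edges α β a b ha hb
    (fun V => (haW V).imp fun W hW => hW.1) (fun V => (hbW' V).imp fun W hW => hW.1)
  rw [hm] at hcount
  rw [Finset.card_image_of_injective _ hpinj, Finset.card_univ]
  refine hcount.trans (Nat.add_le_add_right (le_coverMatching p hpinj _ 𝒰 D σ hσ ?_) _)
  intro i hi
  obtain ⟨W, hWa, hWb⟩ := hD i hi
  obtain ⟨w, hw⟩ := nonempty_of_ncard_le_complexity h𝒲 hr𝒲 hcard𝒲.le W.2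
  obtain ⟨W₁, hW₁, z₁, hz₁, hz₁i⟩ := haW i
  obtain ⟨W₂, hW₂, z₂, hz₂, hz₂j⟩ := hbW' (σ i)
  -- Six links, each costing less than `1/6`, join `p i` to `g * p (σ i)` through `v i`, `z₁`, `w`,
  -- `z₂` and `g * v (σ i)`. As `h U` is `1` at the start, it is positive at the end.
  obtain ⟨U, hU, hUone⟩ := hone (p i)
  have e1 := hpO i 1 (by simp) U hU
  obtain ⟨Vi, hVi, hVi'⟩ := hr' i i.2
  have e2 := hosc' Vi hVi _ (hVi' (hv i)) _ (hVi' hz₁i) 1 (by simp) U hU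
  have e3 := hosc' _ (hα W) _ (by rw [hWa, ← hW₁]; exact hWα W₁ hz₁) _ (hWα W hw) 1 (by simp) U hU
  have hgK : g ∈ insert 1 E := Finset.mem_insert_of_mem hg
  have e4 := hosc' _ (hβ W) _ (hWβ W w hw) _ (by rw [hWb, ← hW₂]; exact hWβ W₂ z₂ hz₂) g hgK U hU
  obtain ⟨Vj, hVj, hVj'⟩ := hr' (σ i) (σ i).2
  have e5 := hosc' Vj hVj _ (hVj' hz₂j) _ (hVj' (hv (σ i))) g hgK U hU
  have e6 := hpO (σ i) g hgK U hU
  simp only [one_mul, mul_inv_cancel_left] at e1 e2 e3 e4 e5 e6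
  rw [abs_lt] at e1 e2 e3 e4 e5 e6
  refine ⟨U, hU, hpos _ _ (by rw [hUone]; norm_num), hpos _ _ ?_⟩
  change 0 < h U (g * p (σ i))
  linarith

/-- Large matchings between `F` and `gF` lead to large matchings between points in general
position. -/
theorem exists_generic_matching [T1Space G] (hG : ¬ DiscreteTopology G)
    {𝒰 : Set (Set G)} (h𝒰 : 𝒰.Finite) {h : Set G → G → ℝ}
    (hc : ∀ U, UniformContinuous (h U)) (h0 : ∀ U x, 0 ≤ h U x) (h1 : ∀ U x, h U x ≤ 1)
    (E : Finset G) {θ : ℝ}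
    (H : ∀ (E : Finset G), ∀ 𝒰 ∈ finUnifCov G, ∃ F : Finset G, F.Nonempty ∧ ∀ g ∈ E,
      θ * F.card ≤ coverMatching F (F.map (Equiv.mulLeft g).toEmbedding) 𝒰)
    (K : Finset G) (N : ℕ) :
    ∃ (n : ℕ) (p : Fin n → G), N < n ∧ (∀ i j, i ≠ j → ∀ k ∈ K, p i ≠ k * p j) ∧
      ∀ g ∈ E, ∃ (D : Finset (Fin n)) (σ : Fin n → Fin n), Set.InjOn σ D ∧ θ * n ≤ D.card ∧
        ∀ i ∈ D, ∀ U ∈ 𝒰, |h U (p i) - h U (g * p (σ i))| < 1 ∧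
          |h U (g⁻¹ * p i) - h U (p (σ i))| < 1 := by
  classical
  -- Inverses are included because closeness is needed both at `g * p (σ i)` and at `g⁻¹ * p i`.
  -- Each comparison has three links, whence `1/3` below.
  let L : Finset G := insert 1 (E ∪ E.image (·⁻¹))
  have hL1 : (1 : G) ∈ L := by simp [L]
  have hLE : ∀ g ∈ E, g ∈ L := fun g hg => by simp [L, hg]
  have hLE' : ∀ g ∈ E, g⁻¹ ∈ L := fun g hg => by simp [L, hg]
  obtain ⟨𝒰', h𝒰', hosc⟩ := exists_finUnifCov_abs_sub_lt h𝒰 hc h0 h1 L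
    (show (0 : ℝ) < 1 / 3 by norm_num)
  obtain ⟨F, hF, hFm⟩ := H E 𝒰' h𝒰'
  -- Perturbing `N + 1` copies of each point gives more than `N` points without lowering the matched
  -- proportion.
  obtain ⟨p, hpO, hpgen⟩ := exists_generic hG (fun i : {x // x ∈ F} × Fin (N + 1) => (i.1 : G)) _
    (fun i => eventually_abs_sub_lt h𝒰 hc L (show (0 : ℝ) < 1 / 3 by norm_num) _) K
  let e := (Fintype.equivFin ({x // x ∈ F} × Fin (N + 1))).symm
  have hcard : Fintype.card ({x // x ∈ F} × Fin (N + 1)) = F.card * (N + 1) := by simp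
  refine ⟨_, p ∘ e, ?_, fun i j hij => hpgen _ _ (e.injective.ne hij), fun g hg => ?_⟩
  · rw [hcard]
    have := hF.card_pos
    nlinarith
  obtain ⟨D, σ, hσ, hD, hDcard⟩ := exists_coverMatching F (Equiv.mulLeft g) 𝒰'
  refine ⟨(D ×ˢ Finset.univ).map e.symm.toEmbedding,
    fun i => e.symm (σ (e i).1, (e i).2), ?_, ?_, ?_⟩
  · intro i hi j hj hij
    simp only [Finset.coe_map, Equiv.coe_toEmbedding, mem_image, Finset.mem_coe,
      Finset.mem_product, Finset.mem_univ, and_true] at hi hj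
    obtain ⟨i, hi, rfl⟩ := hi
    obtain ⟨j, hj, rfl⟩ := hj
    simp only [Equiv.apply_symm_apply, EmbeddingLike.apply_eq_iff_eq, Prod.mk.injEq] at hij
    rw [Prod.ext (hσ hi hj hij.1) hij.2]
  · rw [Finset.card_map, Finset.card_product, hcard, hDcard]
    push_cast
    rw [← mul_assoc, Finset.card_univ, Fintype.card_fin]
    push_cast
    exact mul_le_mul_of_nonneg_right (hFm g hg) (by positivity)
  · intro i hi U hU
    simp only [Finset.mem_map_equiv, Equiv.symm_symm, Finset.mem_product, Finset.mem_univ,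
      and_true] at hi
    obtain ⟨V, hV, hiV, hgV⟩ := hD _ hi
    have a1 := hosc V hV _ hiV _ hgV 1 hL1 U hU
    have a2 := hosc V hV _ hiV _ hgV g⁻¹ (hLE' g hg) U hU
    have b1 := hpO (e i) 1 hL1 U hU
    have b2 := hpO (e i) g⁻¹ (hLE' g hg) U hU
    have c1 := hpO (σ (e i).1, (e i).2) 1 hL1 U hU
    have c2 := hpO (σ (e i).1, (e i).2) g (hLE g hg) U hU
    simp only [one_mul, Equiv.coe_mulLeft, inv_mul_cancel_left] at a1 a2 b1 b2 c1 c2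
    simp only [Function.comp_apply, Equiv.apply_symm_apply]
    rw [abs_lt] at a1 a2 b1 b2 c1 c2 ⊢
    rw [abs_lt]
    refine ⟨⟨?_, ?_⟩, ?_, ?_⟩ <;> linarith

/-- A bound for the complexity of `𝒱 ∨ g(𝒱)`, where `𝒱` consists of the members of `𝒰` punctured
at the points `p i` and of neighbourhoods `V i` of these points. -/
theorem complexity_join_le {𝒰 : Set (Set G)} [T1Space G] (h𝒰 : 𝒰 ∈ finUnifCov G)
    {n : ℕ} (p : Fin n → G) (V : Fin n → Set G) (g : G) (hpg : ∀ i j, p i ≠ g * p j)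
    (hV : ∀ i, V i ∈ 𝓝 (p i)) (D : Finset (Fin n)) (σ : Fin n → Fin n) (hσ : Set.InjOn σ D)
    (hD : ∀ i ∈ D, V i ∈ 𝓝 (g * p (σ i)) ∧ V (σ i) ∈ 𝓝 (g⁻¹ * p i))
    {𝒱 : Set (Set G)} (h𝒱 : 𝒱 = range V ∪ (fun U => U \ range p) '' 𝒰) :
    complexity (join 𝒱 (imageFamily (Equiv.mulLeft g) 𝒱)) + D.card ≤
      2 * n + 𝒰.ncard * 𝒰.ncard := by
  classical
  have hrange : (range p).Finite := finite_range p
  have hVmem : ∀ i, V i ∈ 𝒱 := fun i => h𝒱 ▸ Or.inl (mem_range_self i)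
  have hUmem : ∀ U ∈ 𝒰, U \ range p ∈ 𝒱 := fun U hU => h𝒱 ▸ Or.inr (mem_image_of_mem _ hU)
  choose c hc hcn using fun x => h𝒰.2.exists_mem_nhds x
  have hcn' : ∀ x ∉ range p, c x \ range p ∈ 𝓝 x := fun x hx =>
    Filter.inter_mem (hcn x) (hrange.isClosed.isOpen_compl.mem_nhds hx)
  have hgp : ∀ i, g * p i ∉ range p := by
    rintro i ⟨j, hj⟩
    exact hpg j i hj
  have hgp' : ∀ i, g⁻¹ * p i ∉ range p := by
    rintro i ⟨j, hj⟩
    exact hpg i j (by simp [hj])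
  have himg : ∀ {A : Set G} {x : G}, A ∈ 𝓝 (g⁻¹ * x) → Equiv.mulLeft g '' A ∈ 𝓝 x := by
    intro A x hA
    have := (Homeomorph.mulLeft g).isOpenMap.image_mem_nhds hA
    simpa using this
  -- `A₁ i` serves `p i` and its partner `g * p (σ i)` at once; `A₂` and `A₃` serve the unmatched
  -- points of `F` and `gF`.
  let A₁ : Fin n → Set G := fun i => V i ∩ Equiv.mulLeft g '' V (σ i)
  let A₂ : Fin n → Set G := fun i => V i ∩ Equiv.mulLeft g '' (c (g⁻¹ * p i) \ range p)
  let A₃ : Fin n → Set G := fun j => (c (g * p j) \ range p) ∩ Equiv.mulLeft g '' V j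
  let 𝒜 : Finset (Set G) := D.image A₁ ∪ Dᶜ.image A₂ ∪ (D.image σ)ᶜ.image A₃
  let F : Set G := range p ∪ Equiv.mulLeft g '' range p
  have hF : F.Finite := hrange.union (hrange.image _)
  let 𝒥 : Set (Set G) := join 𝒰 (imageFamily (Equiv.mulLeft g) 𝒰)
  have h𝒥 : 𝒥 ∈ finUnifCov G := join_mem_finUnifCov h𝒰
    (imageFamily_mem_finUnifCov h𝒰 _ (uniformContinuous_leftMul G g⁻¹))
  let 𝒲 : Set (Set G) := 𝒜 ∪ (fun U => U \ F) '' 𝒥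
  have h𝒜₁ : ∀ i ∈ D, A₁ i ∈ (𝒜 : Set (Set G)) := fun i hi => by
    simp only [𝒜, Finset.coe_union, Finset.coe_image]
    exact Or.inl (Or.inl ⟨i, hi, rfl⟩)
  have h𝒜₂ : ∀ i ∉ D, A₂ i ∈ (𝒜 : Set (Set G)) := fun i hi => by
    simp only [𝒜, Finset.coe_union, Finset.coe_image]
    exact Or.inl (Or.inr ⟨i, by simpa using hi, rfl⟩)
  have h𝒜₃ : ∀ j ∉ D.image σ, A₃ j ∈ (𝒜 : Set (Set G)) := fun j hj => by
    simp only [𝒜, Finset.coe_union, Finset.coe_image]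
    exact Or.inr ⟨j, by simpa using hj, rfl⟩
  have h𝒲 : 𝒲 ∈ finUnifCov G := by
    refine ⟨𝒜.finite_toSet.union (h𝒥.1.image _), h𝒥.2.punctured hF ?_⟩
    rintro x (⟨i, rfl⟩ | ⟨-, ⟨j, rfl⟩, rfl⟩)
    · by_cases hi : i ∈ D
      · exact ⟨_, h𝒜₁ i hi, Filter.inter_mem (hV i) (himg (hD i hi).2)⟩
      · exact ⟨_, h𝒜₂ i hi, Filter.inter_mem (hV i) (himg (hcn' _ (hgp' i)))⟩
    · have hgV : Equiv.mulLeft g '' V j ∈ 𝓝 (g * p j) := himg (by simpa using hV j)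
      by_cases hj : j ∈ D.image σ
      · obtain ⟨i, hi, rfl⟩ := Finset.mem_image.1 hj
        exact ⟨_, h𝒜₁ i hi, Filter.inter_mem (hD i hi).1 hgV⟩
      · exact ⟨_, h𝒜₃ j hj, Filter.inter_mem (hcn' _ (hgp j)) hgV⟩
  have hr : Refines (join 𝒱 (imageFamily (Equiv.mulLeft g) 𝒱)) 𝒲 := by
    have hmem : ∀ {A B : Set G}, A ∈ 𝒱 → B ∈ 𝒱 →
        A ∩ Equiv.mulLeft g '' B ∈ join 𝒱 (imageFamily (Equiv.mulLeft g) 𝒱) :=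
      fun hA hB => ⟨_, hA, _, mem_image_of_mem _ hB, rfl⟩
    rintro W (hW | ⟨-, ⟨U, hU, -, ⟨U', hU', rfl⟩, rfl⟩, rfl⟩)
    · simp only [𝒜, Finset.coe_union, Finset.coe_image] at hW
      rcases hW with (⟨i, -, rfl⟩ | ⟨i, -, rfl⟩) | ⟨j, -, rfl⟩
      · exact ⟨_, hmem (hVmem i) (hVmem (σ i)), le_rfl⟩
      · exact ⟨_, hmem (hVmem i) (hUmem _ (hc _)), le_rfl⟩
      · exact ⟨_, hmem (hUmem _ (hc _)) (hVmem j), le_rfl⟩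
    · refine ⟨_, hmem (hUmem U hU) (hUmem U' hU'), ?_⟩
      rintro x ⟨⟨hxU, y, hyU', rfl⟩, hxF⟩
      exact ⟨⟨hxU, fun h => hxF (Or.inl h)⟩, y,
        ⟨hyU', fun h => hxF (Or.inr (mem_image_of_mem _ h))⟩, rfl⟩
  have hcomp := complexity_le h𝒲 hr
  have hcard𝒥 : 𝒥.ncard ≤ 𝒰.ncard * 𝒰.ncard := by
    have h1 : 𝒥 ⊆ (fun q : Set G × Set G => q.1 ∩ Equiv.mulLeft g '' q.2) '' (𝒰 ×ˢ 𝒰) := by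
      rintro _ ⟨U, hU, -, ⟨U', hU', rfl⟩, rfl⟩
      exact ⟨(U, U'), ⟨hU, hU'⟩, rfl⟩
    refine (ncard_le_ncard h1 ((h𝒰.1.prod h𝒰.1).image _)).trans ?_
    refine (ncard_image_le (h𝒰.1.prod h𝒰.1)).trans ?_
    rw [ncard_prod]
  have hcard𝒲 : 𝒲.ncard ≤ 𝒜.card + 𝒰.ncard * 𝒰.ncard := by
    refine (ncard_union_le _ _).trans (add_le_add (ncard_coe_finset _).le ?_)
    exact (ncard_image_le h𝒥.1).trans hcard𝒥
  have hcard𝒜 : 𝒜.card ≤ D.card + Dᶜ.card + ((D.image σ)ᶜ).card :=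
    (Finset.card_union_le _ _).trans (add_le_add ((Finset.card_union_le _ _).trans
      (add_le_add Finset.card_image_le Finset.card_image_le)) Finset.card_image_le)
  rw [Finset.card_compl, Finset.card_compl, Finset.card_image_of_injOn hσ,
    Fintype.card_fin] at hcard𝒜
  have := Finset.card_le_univ D
  rw [Fintype.card_fin] at this
  omega

/-- Disposes of the identity, for which `p i ≠ g * p i` is impossible. -/
theorem complexity_join_imageFamily_one {X : Type*} [UniformSpace X] (𝒱 : Set (Set X))
    (g : Equiv.Perm X) (hg : g = 1) :
    complexity (join 𝒱 (imageFamily g 𝒱)) = complexity 𝒱 := by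
  subst hg
  have himg : imageFamily (1 : Equiv.Perm X) 𝒱 = 𝒱 := by simp [imageFamily]
  have h1 : Refines 𝒱 (join 𝒱 𝒱) := refines_join_left 𝒱 𝒱
  have h2 : Refines (join 𝒱 𝒱) 𝒱 := fun V hV => ⟨V, ⟨V, hV, V, hV, by simp⟩, le_rfl⟩
  rw [himg, complexity, complexity]
  congr 1
  ext n
  exact ⟨fun ⟨𝒲, hW, hr, hn⟩ => ⟨𝒲, hW, h1.trans hr, hn⟩,
    fun ⟨𝒲, hW, hr, hn⟩ => ⟨𝒲, hW, h2.trans hr, hn⟩⟩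

/-- If there are large matchings between `F` and `gF`, then there are arbitrarily fine coverings
`𝒱` for which the complexity of `𝒱 ∨ g(𝒱)` is small. -/
theorem exists_complexity_join_le [T1Space G] (hG : ¬ DiscreteTopology G) {θ : ℝ} (hθ : θ ≤ 1)
    (H : ∀ (E : Finset G), ∀ 𝒰 ∈ finUnifCov G, ∃ F : Finset G, F.Nonempty ∧ ∀ g ∈ E,
      θ * F.card ≤ coverMatching F (F.map (Equiv.mulLeft g).toEmbedding) 𝒰)
    {𝒰 : Set (Set G)} (h𝒰 : 𝒰 ∈ finUnifCov G) (E : Finset G) {ε : ℝ} (hε : 0 < ε) :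
    ∃ 𝒱 ∈ finUnifCov G, Refines 𝒰 𝒱 ∧ ∀ g ∈ E,
      (complexity (join 𝒱 (imageFamily (Equiv.mulLeft g) 𝒱)) : ℝ) / complexity 𝒱 ≤ 2 - θ + ε := by
  classical
  obtain ⟨h, hc, h0, h1, hpos, hone⟩ := h𝒰.2.exists_urysohn
  -- With `n > N` the remainder `|𝒰|²` is at most `ε n`.
  obtain ⟨N, hN⟩ := exists_nat_gt ((𝒰.ncard * 𝒰.ncard : ℝ) / ε)
  obtain ⟨n, p, hn, hgen, hmatch⟩ := exists_generic_matching hG h𝒰.1 hc h0 h1 E H (insert 1 E) N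
  have hpinj : Function.Injective p := fun i j hij => by
    by_contra hne
    exact hgen i j hne 1 (by simp) (by simpa using hij)
  choose U hU hUone using fun i => hone (p i)
  have hUn : ∀ i x, 0 < h (U i) x → U i ∈ 𝓝 x := fun i x hx =>
    Filter.mem_of_superset ((isOpen_lt continuous_const (hc (U i)).continuous).mem_nhds hx)
      fun y hy => hpos _ _ hy
  let V : Fin n → Set G := fun i => U i \ (range p \ {p i})
  have hVn : ∀ i x, 0 < h (U i) x → (x ∈ range p → x = p i) → V i ∈ 𝓝 x := fun i x hx hx' =>
    Filter.inter_mem (hUn i x hx) (((finite_range p).subset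
      sdiff_subset).isClosed.isOpen_compl.mem_nhds fun hmem => hmem.2 (hx' hmem.1))
  have hVp : ∀ i, V i ∈ 𝓝 (p i) := fun i =>
    hVn i _ (by rw [hUone]; exact one_pos) fun _ => rfl
  let 𝒱 : Set (Set G) := range V ∪ (fun U => U \ range p) '' 𝒰
  have h𝒱 : 𝒱 ∈ finUnifCov G := by
    refine ⟨(finite_range V).union (h𝒰.1.image _), h𝒰.2.punctured (finite_range p) ?_⟩
    rintro _ ⟨i, rfl⟩
    exact ⟨V i, mem_range_self i, hVp i⟩
  have hr : Refines 𝒰 𝒱 := by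
    rintro _ (⟨i, rfl⟩ | ⟨W, hW, rfl⟩)
    · exact ⟨U i, hU i, sdiff_subset⟩
    · exact ⟨W, hW, sdiff_subset⟩
  -- Only `V i` contains `p i`, so in any refinement different points lie in different members.
  have hncomp : n ≤ complexity 𝒱 := by
    obtain ⟨𝒲, h𝒲, hr𝒲, hcard⟩ := exists_ncard_eq_complexity h𝒱
    choose w hw hpw using fun i => h𝒲.2.exists_mem (p i)
    have hwinj : Function.Injective w := by
      intro i j hij
      obtain ⟨A, hA, hwA⟩ := hr𝒲 _ (hw i)
      have hi := hwA (hpw i)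
      have hj := hwA (hij ▸ hpw j)
      rcases hA with ⟨k, rfl⟩ | ⟨W, hW, rfl⟩
      · have hk : ∀ l, p l ∈ V k → l = k := fun l hl => by
          by_contra hne
          exact hl.2 ⟨mem_range_self l, fun h => hne (hpinj h)⟩
        rw [hk i hi, hk j hj]
      · exact absurd (mem_range_self i) hi.2
    rw [← hcard, ← Nat.card_coe_set_eq, ← Nat.card_fin n]
    have := h𝒲.1.to_subtype
    exact Nat.card_le_card_of_injective (fun i => (⟨w i, hw i⟩ : 𝒲)) fun i j hij =>
      hwinj (congrArg Subtype.val hij)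
  have hn0 : (0 : ℝ) < n := by exact_mod_cast (Nat.zero_le N).trans_lt hn
  have hncomp' : (n : ℝ) ≤ complexity 𝒱 := by exact_mod_cast hncomp
  refine ⟨𝒱, h𝒱, hr, fun g hg => ?_⟩
  rcases eq_or_ne g 1 with rfl | hg1
  · rw [complexity_join_imageFamily_one 𝒱 _ (by ext; simp), div_self (by linarith)]
    linarith
  obtain ⟨D, σ, hσ, hDcard, hD⟩ := hmatch g hg
  have hpg : ∀ i j, p i ≠ g * p j := fun i j => by
    rcases eq_or_ne i j with rfl | hij
    · exact fun h => hg1 (by simpa using h.symm)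
    · exact hgen i j hij g (Finset.mem_insert_of_mem hg)
  have key := complexity_join_le h𝒰 p V g hpg hVp D σ hσ (fun i hi => by
    have h1 := abs_lt.1 (hD i hi (U i) (hU i)).1
    have h2 := abs_lt.1 (hD i hi (U (σ i)) (hU (σ i))).2
    rw [hUone] at h1 h2
    refine ⟨hVn i _ (by linarith) ?_, hVn (σ i) _ (by linarith) ?_⟩
    · rintro ⟨j, hj⟩
      exact absurd hj (hpg j _)
    · rintro ⟨j, hj⟩
      exact absurd (by simp [hj]) (hpg i j)) (𝒱 := 𝒱) rfl
  have key' : (complexity (join 𝒱 (imageFamily (Equiv.mulLeft g) 𝒱)) : ℝ) + D.card ≤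
      2 * n + 𝒰.ncard * 𝒰.ncard := by exact_mod_cast key
  rw [div_lt_iff₀ hε] at hN
  have hNn : (N : ℝ) ≤ n := by exact_mod_cast hn.le
  -- Passing from `n` to the possibly larger `complexity 𝒱` uses `2 - θ + ε ≥ 0`.
  rw [div_le_iff₀ (by linarith)]
  nlinarith

end Group

/-! ### Means and finite averages -/

theorem UCb_bddAbove {X : Type*} [UniformSpace X] (f : UCb X) :
    BddAbove (range (f : X → ℝ)) := by
  obtain ⟨-, C, hC⟩ := f.2
  exact ⟨C, by rintro _ ⟨x, rfl⟩; exact (le_abs_self _).trans (hC x)⟩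

theorem UCb_bddBelow {X : Type*} [UniformSpace X] (f : UCb X) :
    BddBelow (range (f : X → ℝ)) := by
  obtain ⟨-, C, hC⟩ := f.2
  exact ⟨-C, by rintro _ ⟨x, rfl⟩; exact (abs_le.1 (hC x)).1⟩

/-- Finitely many functions annihilated by a mean are almost annihilated by a convex combination
of point evaluations. -/
theorem exists_convex_combination {X J : Type*} [UniformSpace X] [Nonempty X] [Fintype J]
    {m : UCb X →ₗ[ℝ] ℝ} (hm : IsMean m) (q : J → UCb X) (hq : ∀ j, m (q j) = 0) {η : ℝ}
    (hη : 0 < η) :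
    ∃ (ι : Type) (_ : Fintype ι) (w : ι → ℝ) (y : ι → X), (∀ i, 0 ≤ w i) ∧ ∑ i, w i = 1 ∧
      ∀ j, |∑ i, w i * (q j : X → ℝ) (y i)| < η := by
  classical
  let Q : X → J → ℝ := fun x j => (q j : X → ℝ) x
  have h0 : (0 : J → ℝ) ∈ closure (convexHull ℝ (range Q)) := by
    by_contra hnot
    -- A separating functional would give a combination `r` of the `q j` with `m r = 0` but negative
    -- supremum.
    obtain ⟨f, u, hlt, hu⟩ := geometric_hahn_banach_closed_point
      (convex_convexHull ℝ (range Q)).closure isClosed_closure hnot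
    rw [map_zero] at hu
    let c : J → ℝ := fun j => f (Pi.single j 1)
    let r : UCb X := ∑ j, c j • q j
    have hr : ∀ x, (r : X → ℝ) x = f (Q x) := by
      intro x
      have hQ : Q x = ∑ j, Q x j • (Pi.single j 1 : J → ℝ) := by
        ext i
        simp [Finset.sum_apply, Pi.single_apply]
      rw [hQ, map_sum]
      simp only [map_smul, smul_eq_mul, r, Submodule.coe_sum, Submodule.coe_smul,
        Finset.sum_apply, Pi.smul_apply, c]
      exact Finset.sum_congr rfl fun j _ => mul_comm _ _
    have hmr : m r = 0 := by simp [r, hq]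
    have h1 := (hm r).2
    rw [hmr] at h1
    have h2 : ⨆ x, (r : X → ℝ) x ≤ u := ciSup_le fun x => by
      rw [hr]
      exact (hlt _ (subset_closure (subset_convexHull ℝ _ (mem_range_self x)))).le
    linarith
  obtain ⟨z, hz, hdist⟩ := Metric.mem_closure_iff.1 h0 η hη
  obtain ⟨ι, _, w, y, hw, hw1, hy, hsum⟩ := mem_convexHull_iff_exists_fintype.1 hz
  choose x hx using hy
  refine ⟨ι, inferInstance, w, x, hw, hw1, fun j => ?_⟩
  have h1 := (dist_pi_lt_iff hη).1 hdist j
  rw [← hsum, dist_comm, Real.dist_eq] at h1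
  simpa [← hx, Q, Finset.sum_apply] using h1

/-- Finitely many functions annihilated by a mean have small averages over a suitable finite
family of points. -/
theorem exists_finite_average {X J : Type*} [UniformSpace X] [Nonempty X] [Fintype J]
    {m : UCb X →ₗ[ℝ] ℝ} (hm : IsMean m) (q : J → UCb X) (hq : ∀ j, m (q j) = 0)
    (hq1 : ∀ j x, |(q j : X → ℝ) x| ≤ 1) {η : ℝ} (hη : 0 < η) :
    ∃ (n : ℕ) (x : Fin n → X), 0 < n ∧ ∀ j, |∑ i, (q j : X → ℝ) (x i)| ≤ η * n := by
  obtain ⟨ι, _, w, y, hw, hw1, hsmall⟩ := exists_convex_combination hm q hq (half_pos hη)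
  -- Each point `y i` is repeated `⌈N * w i⌉₊` times; rounding costs at most `1` per point, in total
  -- less than `N * (η / 2)`.
  obtain ⟨N, hN⟩ := exists_nat_gt ((Fintype.card ι : ℝ) / (η / 2))
  have hN0 : (0 : ℝ) < N := lt_of_le_of_lt (by positivity) hN
  rw [div_lt_iff₀ (half_pos hη)] at hN
  let κ := Σ i : ι, Fin ⌈N * w i⌉₊
  let e : Fin (Fintype.card κ) ≃ κ := (Fintype.equivFin κ).symm
  have hceil : ∀ i, |(⌈N * w i⌉₊ : ℝ) - N * w i| ≤ 1 := fun i => by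
    have h1 := Nat.le_ceil (N * w i)
    have h2 := Nat.ceil_lt_add_one (mul_nonneg hN0.le (hw i))
    rw [abs_le]
    constructor <;> linarith
  have hcard : (N : ℝ) ≤ Fintype.card κ := by
    have h1 : (Fintype.card κ : ℝ) = ∑ i, (⌈N * w i⌉₊ : ℝ) := by simp [κ]
    rw [h1]
    calc (N : ℝ) = ∑ i, N * w i := by rw [← Finset.mul_sum, hw1, mul_one]
      _ ≤ _ := Finset.sum_le_sum fun i _ => Nat.le_ceil _
  refine ⟨Fintype.card κ, fun k => y (e k).1, by exact_mod_cast hN0.trans_le hcard, fun j => ?_⟩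
  have h1 : ∑ k, (q j : X → ℝ) (y (e k).1) = ∑ i, (⌈N * w i⌉₊ : ℝ) * (q j : X → ℝ) (y i) := by
    rw [e.sum_comp (fun k : κ => (q j : X → ℝ) (y k.1)), Fintype.sum_sigma]
    simp
  have h2 : ∑ i, (⌈N * w i⌉₊ : ℝ) * (q j : X → ℝ) (y i) =
      N * (∑ i, w i * (q j : X → ℝ) (y i)) +
        ∑ i, ((⌈N * w i⌉₊ : ℝ) - N * w i) * (q j : X → ℝ) (y i) := by
    rw [Finset.mul_sum, ← Finset.sum_add_distrib]
    exact Finset.sum_congr rfl fun i _ => by ring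
  have h3 : |∑ i, ((⌈N * w i⌉₊ : ℝ) - N * w i) * (q j : X → ℝ) (y i)| ≤ Fintype.card ι := by
    refine (Finset.abs_sum_le_sum_abs _ _).trans ?_
    refine (Finset.sum_le_card_nsmul _ _ 1 fun i _ => ?_).trans (by simp)
    rw [abs_mul]
    exact mul_le_one₀ (hceil i) (abs_nonneg _) (hq1 j _)
  rw [h1, h2]
  refine (abs_add_le _ _).trans ?_
  rw [abs_mul, abs_of_pos hN0]
  have h4 := mul_le_mul_of_nonneg_left (hsmall j).le hN0.le
  nlinarith

/-! ### Amenability and almost perfect matchings. -/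

section Group

attribute [local instance] IsTopologicalGroup.rightUniformSpace

variable {G : Type*} [Group G] [TopologicalSpace G] [IsTopologicalGroup G]

theorem comp_leftMul_mem_UCb (f : UCb G) (g : G) : (fun x => (f : G → ℝ) (g * x)) ∈ UCb G := by
  obtain ⟨hf, C, hC⟩ := f.2
  exact ⟨hf.comp (uniformContinuous_leftMul G g), C, fun x => hC _⟩

/-- The functions `Φ I`, maxima of the Urysohn functions indexed by `I`, detect Hall's condition. If
`I` collects the `U` with `h U` positive somewhere on `S`, then `Φ I` is `1` on `S`, and `Φ I (g * x
j)` vanishes unless `j` is a neighbour of `S`. Almost invariance of the sum of `Φ I` thus bounds the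
defect by `η * n`. -/
theorem GroupAmenable.exists_coverMatching [T1Space G] (hG : ¬ DiscreteTopology G)
    (hA : GroupAmenable G) (E : Finset G) {𝒰 : Set (Set G)} (h𝒰 : 𝒰 ∈ finUnifCov G) {η : ℝ}
    (hη : 0 < η) :
    ∃ F : Finset G, F.Nonempty ∧ ∀ g ∈ E,
      (1 - η) * F.card ≤ coverMatching F (F.map (Equiv.mulLeft g).toEmbedding) 𝒰 := by
  classical
  obtain ⟨m, hm, hinv⟩ := hA
  obtain ⟨h, hc, h0, h1, hpos, hone⟩ := h𝒰.2.exists_urysohn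
  let Φ : Finset (Set G) → G → ℝ := fun I x => ‖fun U : I => h U x‖
  have hΦ0 : ∀ I x, 0 ≤ Φ I x := fun I x => norm_nonneg _
  have hΦ1 : ∀ I x, Φ I x ≤ 1 := fun I x => by
    refine (pi_norm_le_iff_of_nonneg zero_le_one).2 fun U => ?_
    rw [Real.norm_eq_abs, abs_of_nonneg (h0 _ _)]
    exact h1 _ _
  have hΦle : ∀ I x, ∀ U ∈ I, h U x ≤ Φ I x := fun I x U hU =>
    (le_abs_self _).trans (norm_le_pi_norm (fun U : I => h U x) ⟨U, hU⟩)
  have hΦpos : ∀ I x, (∀ U ∈ I, h U x ≤ 0) → Φ I x ≤ 0 := fun I x hx => by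
    refine (pi_norm_le_iff_of_nonneg le_rfl).2 fun U => ?_
    rw [Real.norm_eq_abs, abs_of_nonneg (h0 _ _)]
    exact hx U U.2
  have hΦmem : ∀ I, Φ I ∈ UCb G := fun I =>
    ⟨uniformContinuous_norm.comp (uniformContinuous_pi.2 fun U => hc U), 1, fun x => by
      rw [abs_of_nonneg (hΦ0 I x)]; exact hΦ1 I x⟩
  let P := h𝒰.1.toFinset.powerset
  let q : P × E → UCb G := fun j =>
    ⟨_, comp_leftMul_mem_UCb ⟨Φ j.1, hΦmem j.1⟩ j.2⟩ - ⟨Φ j.1, hΦmem j.1⟩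
  have hq : ∀ j x, (q j : G → ℝ) x = Φ j.1 (j.2 * x) - Φ j.1 x := fun j x => rfl
  have hqm : ∀ j, m (q j) = 0 := fun j => by
    rw [map_sub, sub_eq_zero]
    exact (hinv _ (MonoidHom.mem_range.2 ⟨j.2, rfl⟩) _ _ rfl).symm
  obtain ⟨n, x, hn, hx⟩ := exists_finite_average hm q hqm (fun j x => by
    rw [hq, abs_le]
    constructor <;> linarith [hΦ0 j.1 x, hΦ1 j.1 x, hΦ0 j.1 (j.2 * x), hΦ1 j.1 (j.2 * x)]) hη
  have hopen : ∀ i, {p | ∀ g ∈ insert 1 E, ∀ U ∈ 𝒰, 0 < h U (g * x i) → 0 < h U (g * p)} ∈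
      𝓝 (x i) := by
    intro i
    change ∀ᶠ p in 𝓝 (x i), ∀ g ∈ insert 1 E, ∀ U ∈ 𝒰, 0 < h U (g * x i) → 0 < h U (g * p)
    rw [Filter.eventually_all_finset]
    intro g _
    rw [Filter.eventually_all_finite h𝒰.1]
    intro U _
    have hcont : Continuous fun p => h U (g * p) :=
      (hc U).continuous.comp (continuous_const.mul continuous_id)
    by_cases hp : 0 < h U (g * x i)
    · exact (hcont.tendsto (x i)).eventually_const_lt hp |>.mono fun _ h' _ => h'
    · exact Filter.Eventually.of_forall fun _ h' => absurd h' hp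
  -- The points `x i` may repeat; the perturbed ones are distinct and keep every positivity used by
  -- the matching.
  obtain ⟨p, hpO, hpgen⟩ := exists_generic hG x _ hopen {1}
  have hpinj : Function.Injective p := fun i j hij => by
    by_contra hne
    exact hpgen i j hne 1 (by simp) (by simpa using hij)
  have : Nonempty (Fin n) := ⟨⟨0, hn⟩⟩
  refine ⟨Finset.univ.image p, Finset.univ_nonempty.image p, fun g hg => ?_⟩
  let t : Fin n → Finset (Fin n) := fun i => Finset.univ.filter fun j =>
    ∃ U ∈ 𝒰, 0 < h U (x i) ∧ 0 < h U (g * x j)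
  obtain ⟨D, σ, hσ, hD, hcard⟩ := exists_partial_transversal t ⌊η * n⌋₊ (by
    intro S
    let I : Finset (Set G) := h𝒰.1.toFinset.filter fun U => ∃ i ∈ S, 0 < h U (x i)
    have hI : I ∈ P := Finset.mem_powerset.2 (Finset.filter_subset _ _)
    have e1 : (S.card : ℝ) ≤ ∑ i, Φ I (x i) := by
      calc (S.card : ℝ) = ∑ i ∈ S, (1 : ℝ) := by simp
        _ ≤ ∑ i ∈ S, Φ I (x i) := Finset.sum_le_sum fun i hi => by
          obtain ⟨U, hU, hU1⟩ := hone (x i)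
          rw [← hU1]
          refine hΦle I _ U (Finset.mem_filter.2 ⟨h𝒰.1.mem_toFinset.2 hU, i, hi, ?_⟩)
          rw [hU1]
          exact one_pos
        _ ≤ _ := Finset.sum_le_univ_sum_of_nonneg fun i => hΦ0 _ _
    have e2 : ∑ j, Φ I (g * x j) ≤ (S.biUnion t).card := by
      calc ∑ j, Φ I (g * x j) ≤ ∑ j, if j ∈ S.biUnion t then (1 : ℝ) else 0 :=
            Finset.sum_le_sum fun j _ => by
              split_ifs with hj
              · exact hΦ1 _ _
              · refine hΦpos _ _ fun U hU => ?_
                by_contra hlt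
                obtain ⟨hU, i, hi, hUi⟩ := Finset.mem_filter.1 hU
                exact hj (Finset.mem_biUnion.2 ⟨i, hi, Finset.mem_filter.2 ⟨Finset.mem_univ _, U,
                  h𝒰.1.mem_toFinset.1 hU, hUi, not_le.1 hlt⟩⟩)
        _ = _ := by rw [Finset.sum_boole, Finset.filter_mem_eq_inter, Finset.univ_inter]
    have e3 := (abs_le.1 (hx (⟨I, hI⟩, ⟨g, hg⟩))).1
    simp only [hq, Finset.sum_sub_distrib] at e3
    have e4 : ((S.card - (S.biUnion t).card : ℕ) : ℝ) ≤ η * n := by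
      rcases le_total S.card (S.biUnion t).card with hle | hle
      · rw [Nat.sub_eq_zero_of_le hle]
        push_cast
        positivity
      · push_cast [hle]
        linarith
    have := Nat.le_floor e4
    omega)
  have e5 := le_coverMatching p hpinj (Equiv.mulLeft g) 𝒰 D σ hσ (by
    intro i hi
    obtain ⟨U, hU, hUi, hUj⟩ := (Finset.mem_filter.1 (hD i hi)).2
    refine ⟨U, hU, hpos _ _ ?_, hpos _ _ ?_⟩
    · simpa using hpO i 1 (by simp) U hU (by simpa using hUi)
    · exact hpO (σ i) g (Finset.mem_insert_of_mem hg) U hU hUj)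
  rw [Finset.card_image_of_injective _ hpinj, Finset.card_univ, Fintype.card_fin]
  rw [Fintype.card_fin] at hcard
  have e6 : (n : ℝ) ≤ D.card + ⌊η * n⌋₊ := by exact_mod_cast hcard
  have e7 : (⌊η * n⌋₊ : ℝ) ≤ η * n := Nat.floor_le (by positivity)
  have e8 : (D.card : ℝ) ≤ coverMatching (Finset.univ.image p)
    ((Finset.univ.image p).map (Equiv.mulLeft g).toEmbedding) 𝒰 := by exact_mod_cast e5
  linarith

/-- Almost perfect matchings between `F` and `gF` yield almost invariant averages. -/
theorem exists_almost_invariant_average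
    (H : ∀ η > (0 : ℝ), ∀ (E : Finset G), ∀ 𝒰 ∈ finUnifCov G, ∃ F : Finset G, F.Nonempty ∧
      ∀ g ∈ E, (1 - η) * F.card ≤ coverMatching F (F.map (Equiv.mulLeft g).toEmbedding) 𝒰)
    (E : Finset G) (Q : Finset (UCb G)) {ε : ℝ} (hε : 0 < ε) :
    ∃ F : Finset G, F.Nonempty ∧ ∀ g ∈ E, ∀ f ∈ Q,
      |∑ x ∈ F, (f : G → ℝ) x - ∑ x ∈ F, (f : G → ℝ) (g * x)| ≤ ε * F.card := by
  classical
  choose hUC C hC using fun f : UCb G => f.2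
  let M : ℝ := 1 + ∑ f ∈ Q, |C f|
  have hM0 : 0 < M := by positivity
  have hM : ∀ f ∈ Q, ∀ x, |(f : G → ℝ) x| ≤ M := fun f hf x => by
    have := Finset.single_le_sum (f := fun f => |C f|) (fun f _ => abs_nonneg _) hf
    linarith [hC f x, le_abs_self (C f)]
  obtain ⟨𝒰, h𝒰, hosc⟩ := exists_finUnifCov_dist_lt (fun (x : G) (f : Q) => (f.1 : G → ℝ) x)
    (uniformContinuous_pi.2 fun f => hUC f.1) M (fun x f => hM f f.2 x) (half_pos hε)
  -- Unmatched points cost `ε / 4` on each side, matched pairs `ε / 2`, all relative to `F.card`.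
  obtain ⟨F, hF, hFE⟩ := H (ε / (4 * M)) (by positivity) E 𝒰 h𝒰
  refine ⟨F, hF, fun g hg f hf => ?_⟩
  obtain ⟨D, σ, hσ, hD, hcard⟩ := exists_coverMatching F (Equiv.mulLeft g) 𝒰
  have hcard' := hFE g hg
  rw [← hcard] at hcard'
  have hsum : ∀ (S : Finset {x // x ∈ F}) (u : G → ℝ), (∀ x, |u x| ≤ M) →
      |∑ x ∈ F, u x - ∑ x ∈ S, u x| ≤ (F.card - S.card) * M := by
    intro S u hu
    rw [← Finset.sum_coe_sort F, ← Finset.sum_add_sum_compl S, add_sub_cancel_left]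
    refine (Finset.abs_sum_le_sum_abs _ _).trans ?_
    refine (Finset.sum_le_card_nsmul _ _ M fun i _ => hu _).trans (le_of_eq ?_)
    rw [Finset.card_compl, nsmul_eq_mul, Nat.cast_sub (Finset.card_le_univ S),
      Fintype.card_coe]
  have s1 := hsum D _ (hM f hf)
  have s2 := hsum (D.image σ) (fun x => (f : G → ℝ) (g * x)) (fun x => hM f hf _)
  rw [Finset.sum_image hσ, Finset.card_image_of_injOn hσ] at s2
  have s3 : |∑ x ∈ D, (f : G → ℝ) x - ∑ x ∈ D, (f : G → ℝ) (g * σ x)| ≤ D.card * (ε / 2) := by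
    rw [← Finset.sum_sub_distrib, ← nsmul_eq_mul]
    refine (Finset.abs_sum_le_sum_abs _ _).trans (Finset.sum_le_card_nsmul _ _ _ fun i hi => ?_)
    obtain ⟨U, hU, hiU, hgU⟩ := hD i hi
    have := (dist_pi_lt_iff (half_pos hε)).1 (hosc U hU _ hiU _ hgU) ⟨f, hf⟩
    rw [Real.dist_eq] at this
    exact this.le
  have s4 : (F.card - D.card : ℝ) * M ≤ ε / 4 * F.card := by
    have : (F.card - D.card : ℝ) ≤ ε / (4 * M) * F.card := by linarith
    calc (F.card - D.card : ℝ) * M ≤ ε / (4 * M) * F.card * M :=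
          mul_le_mul_of_nonneg_right this hM0.le
      _ = _ := by field_simp
  have s5 : (D.card : ℝ) * (ε / 2) ≤ F.card * (ε / 2) := by
    have := Finset.card_le_univ D
    rw [Fintype.card_coe] at this
    gcongr
  rw [abs_le] at s1 s2 s3 ⊢
  constructor <;> linarith

/-- The mean is a limit of averages along an ultrafilter on triples recording finitely many
translations, finitely many functions and a precision. -/
theorem groupAmenable_of_coverMatching
    (H : ∀ η > (0 : ℝ), ∀ (E : Finset G), ∀ 𝒰 ∈ finUnifCov G, ∃ F : Finset G, F.Nonempty ∧
      ∀ g ∈ E, (1 - η) * F.card ≤ coverMatching F (F.map (Equiv.mulLeft g).toEmbedding) 𝒰) :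
    GroupAmenable G := by
  classical
  choose F hF hFinv using fun i : Finset G × Finset (UCb G) × ℕ =>
    exists_almost_invariant_average H i.1 i.2.1 (show (0 : ℝ) < 1 / (i.2.2 + 1) by positivity)
  let 𝔲 : Ultrafilter (Finset G × Finset (UCb G) × ℕ) := Ultrafilter.of Filter.atTop
  have h𝔲 : (𝔲 : Filter (Finset G × Finset (UCb G) × ℕ)) ≤ Filter.atTop := Ultrafilter.of_le _
  let a : UCb G → Finset G × Finset (UCb G) × ℕ → ℝ := fun f i =>
    (∑ x ∈ F i, (f : G → ℝ) x) / (F i).card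
  have hpos : ∀ i, (0 : ℝ) < (F i).card := fun i => by exact_mod_cast (hF i).card_pos
  have hlow : ∀ (f : UCb G) i, ⨅ x, (f : G → ℝ) x ≤ a f i := fun f i => by
    rw [le_div_iff₀ (hpos i), mul_comm, ← nsmul_eq_mul]
    exact Finset.card_nsmul_le_sum _ _ _ fun x _ => ciInf_le (UCb_bddBelow f) x
  have hup : ∀ (f : UCb G) i, a f i ≤ ⨆ x, (f : G → ℝ) x := fun f i => by
    rw [div_le_iff₀ (hpos i), mul_comm, ← nsmul_eq_mul]
    exact Finset.sum_le_card_nsmul _ _ _ fun x _ => le_ciSup (UCb_bddAbove f) x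
  have hlim : ∀ f, ∃ l, Filter.Tendsto (a f) 𝔲 (𝓝 l) := fun f => by
    obtain ⟨l, -, hl⟩ := (isCompact_Icc (a := ⨅ x, (f : G → ℝ) x)
      (b := ⨆ x, (f : G → ℝ) x)).ultrafilter_le_nhds (𝔲.map (a f)) (by
        rw [Filter.le_principal_iff]
        exact Filter.mem_map.2 (Filter.univ_mem' fun i => ⟨hlow f i, hup f i⟩))
    exact ⟨l, hl⟩
  choose L hL using hlim
  let m : UCb G →ₗ[ℝ] ℝ :=
    { toFun := L
      map_add' := fun f f' => tendsto_nhds_unique (hL _) (((hL f).add (hL f')).congr fun i => by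
        simp [a, Finset.sum_add_distrib, add_div])
      map_smul' := fun c f => tendsto_nhds_unique (hL _) (((hL f).const_mul c).congr fun i => by
        simp [a, ← Finset.mul_sum, mul_div_assoc]) }
  refine ⟨m, fun f => ⟨ge_of_tendsto (hL f) (Filter.Eventually.of_forall (hlow f)),
    le_of_tendsto (hL f) (Filter.Eventually.of_forall (hup f))⟩, ?_⟩
  rintro _ ⟨g, rfl⟩ f f' hff'
  have hf' : ∀ x, (f' : G → ℝ) x = (f : G → ℝ) (g * x) := fun x => congrFun hff' x
  change L f = L f'
  have hdiff : ∀ k : ℕ, |L f - L f'| ≤ 1 / (k + 1) := fun k => by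
    refine le_of_tendsto ((hL f).sub (hL f')).abs (h𝔲 ?_)
    filter_upwards [Filter.eventually_ge_atTop (({g}, {f}, k) :
      Finset G × Finset (UCb G) × ℕ)] with i hi
    have h1 := hFinv i g (hi.1 (by simp)) f (hi.2.1 (by simp))
    have h2 : a f i - a f' i =
        (∑ x ∈ F i, (f : G → ℝ) x - ∑ x ∈ F i, (f : G → ℝ) (g * x)) / (F i).card := by
      simp only [a, hf', sub_div]
    rw [h2, abs_div, abs_of_pos (hpos i), div_le_iff₀ (hpos i)]
    refine h1.trans (mul_le_mul_of_nonneg_right ?_ (hpos i).le)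
    have h3 : k ≤ i.2.2 := hi.2.2
    gcongr
  have h0 : |L f - L f'| ≤ 0 := ge_of_tendsto' tendsto_one_div_add_atTop_nhds_zero_nat hdiff
  exact sub_eq_zero.1 (abs_nonpos_iff.1 h0)

end Group

/-! ### The two invariants -/

section Group

attribute [local instance] IsTopologicalGroup.rightUniformSpace

variable {G : Type*} [Group G] [TopologicalSpace G] [IsTopologicalGroup G]

theorem exists_finset_leftTranslation (E : Finset (leftTranslation G).range) :
    ∃ E' : Finset G, ∀ g ∈ E, ∃ a ∈ E', ((g : unifAut G) : Equiv.Perm G) = Equiv.mulLeft a := by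
  classical
  choose a ha using fun g : (leftTranslation G).range => MonoidHom.mem_range.1 g.2
  exact ⟨E.image a, fun g hg => ⟨a g, Finset.mem_image_of_mem _ hg,
    (congrArg Subtype.val (ha g)).symm⟩⟩

/-- Trades the extended-real bounds for finite sets; the slack `η` is there because the supremum
over `F` need not be attained. -/
theorem le_groupMatching_iff {θ : ℝ} :
    (θ : EReal) ≤ groupMatching G ↔ ∀ η > (0 : ℝ), ∀ (E : Finset G), ∀ 𝒰 ∈ finUnifCov G,
      ∃ F : Finset G, F.Nonempty ∧ ∀ g ∈ E,
        (θ - η) * F.card ≤ coverMatching F (F.map (Equiv.mulLeft g).toEmbedding) 𝒰 := by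
  classical
  constructor
  · intro h η hη E 𝒰 h𝒰
    let E' : Finset (leftTranslation G).range := E.image (leftTranslation G).rangeRestrict
    have h1 : ((θ - η : ℝ) : EReal) < groupMatching G :=
      lt_of_lt_of_le (EReal.coe_lt_coe_iff.2 (by linarith)) h
    have h2 := h1.trans_le ((iInf_le _ E').trans (iInf₂_le 𝒰 h𝒰))
    obtain ⟨F, hF⟩ := lt_iSup_iff.1 h2
    obtain ⟨hF0, hF⟩ := lt_iSup_iff.1 hF
    refine ⟨F, hF0, fun g hg => ?_⟩
    have h3 := hF.le.trans (iInf₂_le ((leftTranslation G).rangeRestrict g)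
      (Finset.mem_image_of_mem _ hg))
    rw [EReal.coe_le_coe_iff, le_div_iff₀ (by exact_mod_cast hF0.card_pos)] at h3
    exact h3
  · intro h
    refine EReal.ge_of_forall_gt_iff_ge.1 fun z hz => ?_
    rw [EReal.coe_lt_coe_iff] at hz
    refine le_iInf fun E => le_iInf₂ fun 𝒰 h𝒰 => ?_
    obtain ⟨E', hE'⟩ := exists_finset_leftTranslation E
    obtain ⟨F, hF, hFE⟩ := h (θ - z) (by linarith) E' 𝒰 h𝒰
    refine le_iSup₂_of_le F hF (le_iInf₂ fun g hg => ?_)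
    obtain ⟨a, ha, hga⟩ := hE' g hg
    rw [hga, EReal.coe_le_coe_iff, le_div_iff₀ (by exact_mod_cast hF.card_pos)]
    simpa using hFE a ha

theorem groupAmenable_iff_one_le_groupMatching [T1Space G] (hG : ¬ DiscreteTopology G) :
    GroupAmenable G ↔ ((1 : ℝ) : EReal) ≤ groupMatching G := by
  rw [le_groupMatching_iff]
  exact ⟨fun h η hη E 𝒰 h𝒰 => h.exists_coverMatching hG E h𝒰 hη, groupAmenable_of_coverMatching⟩

theorem univ_mem_finUnifCov (X : Type*) [UniformSpace X] : {univ} ∈ finUnifCov X :=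
  ⟨finite_singleton _, univ, Filter.univ_mem, fun _ => ⟨univ, rfl, subset_univ _⟩⟩

theorem groupMatching_nonneg : ((0 : ℝ) : EReal) ≤ groupMatching G := by
  refine le_groupMatching_iff.2 fun η hη E 𝒰 _ => ⟨{1}, Finset.singleton_nonempty _, fun g _ => ?_⟩
  have : (0 : ℝ) ≤
    coverMatching {1} (({1} : Finset G).map (Equiv.mulLeft g).toEmbedding) 𝒰 := Nat.cast_nonneg _
  simp only [Finset.card_singleton]
  push_cast
  linarith

theorem groupMatching_le_one : groupMatching G ≤ ((1 : ℝ) : EReal) := by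
  -- A non-empty `E` is needed: for `E = ∅` the inner infimum is `⊤`.
  refine (iInf_le _ {1}).trans ((iInf₂_le {univ} (univ_mem_finUnifCov G)).trans ?_)
  refine iSup₂_le fun F hF => (iInf₂_le 1 (Finset.mem_singleton_self _)).trans ?_
  rw [EReal.coe_le_coe_iff, div_le_one (by exact_mod_cast hF.card_pos)]
  exact_mod_cast matchingNumber_le_card _ _ _

/-- The strict inequality supplies a refinement `𝒱` of `𝒰'` with all ratios below `d`; what remains
of `2 * F.card` must be matched. -/
theorem le_groupMatching_of_groupComplexity_lt [T1Space G] (hG : ¬ DiscreteTopology G) {d : ℝ}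
    (hd : groupComplexity G < d) : ((2 - d : ℝ) : EReal) ≤ groupMatching G := by
  classical
  refine le_groupMatching_iff.2 fun η hη E 𝒰 h𝒰 => ?_
  obtain ⟨𝒰', h𝒰', hF⟩ := exists_le_coverMatching_add_complexity hG h𝒰 E
  let E' : Finset (leftTranslation G).range := E.image (leftTranslation G).rangeRestrict
  have h1 := ((le_iSup₂ (f := fun 𝒰 (_ : 𝒰 ∈ finUnifCov G) =>
    ⨅ 𝒱 ∈ {𝒱 ∈ finUnifCov G | Refines 𝒰 𝒱}, ⨆ g ∈ E',
      (((complexity (join 𝒱 (imageFamily ((g : unifAut G) : Equiv.Perm G) 𝒱)) : ℝ) /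
        (complexity 𝒱 : ℝ) : ℝ) : EReal)) 𝒰' h𝒰').trans
    (le_iSup (fun E : Finset (leftTranslation G).range => ⨆ 𝒰 ∈ finUnifCov G,
    ⨅ 𝒱 ∈ {𝒱 ∈ finUnifCov G | Refines 𝒰 𝒱}, ⨆ g ∈ E,
      (((complexity (join 𝒱 (imageFamily ((g : unifAut G) : Equiv.Perm G) 𝒱)) : ℝ) /
        (complexity 𝒱 : ℝ) : ℝ) : EReal)) E')).trans_lt hd
  obtain ⟨𝒱, h𝒱⟩ := iInf_lt_iff.1 h1
  obtain ⟨⟨h𝒱, hr⟩, hlt⟩ := iInf_lt_iff.1 h𝒱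
  obtain ⟨F, hcard, hFE⟩ := hF 𝒱 h𝒱 hr
  have hpos : 0 < complexity 𝒱 := complexity_pos h𝒱
  refine ⟨F, Finset.card_pos.1 (hcard ▸ hpos), fun g hg => ?_⟩
  have h2 := (le_iSup₂ (f := fun (g : (leftTranslation G).range) (_ : g ∈ E') =>
    (((complexity (join 𝒱 (imageFamily ((g : unifAut G) : Equiv.Perm G) 𝒱)) : ℝ) /
        (complexity 𝒱 : ℝ) : ℝ) : EReal)) ((leftTranslation G).rangeRestrict g)
      (Finset.mem_image_of_mem _ hg)).trans_lt hlt
  rw [EReal.coe_lt_coe_iff, div_lt_iff₀ (by exact_mod_cast hpos), ← hcard] at h2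
  change (complexity (join 𝒱 (imageFamily (Equiv.mulLeft g) 𝒱)) : ℝ) < d * F.card at h2
  have h3 : (2 * F.card : ℝ) ≤ coverMatching F (F.map (Equiv.mulLeft g).toEmbedding) 𝒰 +
      complexity (join 𝒱 (imageFamily (Equiv.mulLeft g) 𝒱)) := by exact_mod_cast hFE g hg
  have h4 : 0 ≤ η * F.card := by positivity
  linarith

theorem groupComplexity_le_of_le_groupMatching [T1Space G] (hG : ¬ DiscreteTopology G) {θ : ℝ}
    (hθ : θ ≤ 1) (h : (θ : EReal) ≤ groupMatching G) :
    groupComplexity G ≤ ((2 - θ : ℝ) : EReal) := by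
  refine EReal.le_of_forall_lt_iff_le.1 fun z hz => ?_
  rw [EReal.coe_lt_coe_iff] at hz
  refine iSup_le fun E => iSup₂_le fun 𝒰 h𝒰 => ?_
  obtain ⟨E', hE'⟩ := exists_finset_leftTranslation E
  -- Half of the gap is lost in the matching proportion, half in the remainder `ε`.
  have hη : 0 < (z - (2 - θ)) / 2 := by linarith
  obtain ⟨𝒱, h𝒱, hr, h𝒱E⟩ := exists_complexity_join_le hG
    (θ := θ - (z - (2 - θ)) / 2) (by linarith) (le_groupMatching_iff.1 h _ hη) h𝒰 E' hη
  refine iInf₂_le_of_le 𝒱 ⟨h𝒱, hr⟩ (iSup₂_le fun g hg => ?_)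
  obtain ⟨a, ha, hga⟩ := hE' g hg
  rw [hga, EReal.coe_le_coe_iff]
  linarith [h𝒱E a ha]

/-- The bounds `0` and `1` make the matching number real, so that `2 - μ` is an ordinary difference.
-/
theorem groupComplexity_eq [T1Space G] (hG : ¬ DiscreteTopology G) :
    ∃ μ : ℝ, groupMatching G = μ ∧ μ ≤ 1 ∧ groupComplexity G = ((2 - μ : ℝ) : EReal) := by
  have h0 := groupMatching_nonneg (G := G)
  have h1 := groupMatching_le_one (G := G)
  obtain ⟨μ, hμ⟩ : ∃ μ : ℝ, groupMatching G = μ :=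
    ⟨_, (EReal.coe_toReal (ne_top_of_le_ne_top (EReal.coe_ne_top _) h1)
      (ne_bot_of_le_ne_bot (EReal.coe_ne_bot _) h0)).symm⟩
  have hμ1 : μ ≤ 1 := by rwa [hμ, EReal.coe_le_coe_iff] at h1
  refine ⟨μ, hμ, hμ1, le_antisymm (groupComplexity_le_of_le_groupMatching hG hμ1 hμ.ge) ?_⟩
  refine EReal.le_of_forall_lt_iff_le.1 fun d hd => ?_
  have := le_groupMatching_of_groupComplexity_lt hG hd
  rw [hμ, EReal.coe_le_coe_iff] at this
  rw [EReal.coe_le_coe_iff]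
  linarith

end Group

end AsympUnif

theorem corollary6p7 (G : Type*) [Group G] [TopologicalSpace G] [IsTopologicalGroup G]
    [T2Space G] (hG : ¬ DiscreteTopology G) :
    AsympUnif.groupComplexity G = 2 - AsympUnif.groupMatching G ∧
      (AsympUnif.GroupAmenable G ↔ AsympUnif.groupComplexity G = 1) := by
  obtain ⟨μ, hμ, hμ1, hω⟩ := AsympUnif.groupComplexity_eq hG
  constructor
  · rw [hω, hμ, EReal.coe_sub]
    rfl
  · rw [AsympUnif.groupAmenable_iff_one_le_groupMatching hG, hω, hμ, EReal.coe_le_coe_iff,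
      ← EReal.coe_one, EReal.coe_eq_coe_iff]
    constructor <;> intro h <;> linarith
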